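/- **Setting.** Let $H_{\mathbb R}$ be a separable real Hilbert space and $H$ its complexification, with inner product $\langle\cdot,\cdot\rangle$ antilinear on the left and linear on the right. Let $x\mapsto\bar x$ be a complex-linear self-adjoint involution of $H$, i.e. $\bar{\bar x}=x$ and $\langle\bar x,y\rangle=\langle x,\bar y\rangle$. Let $\Sigma(n)$ be the Coxeter group of type B, i.e. the group of bijections $\sigma$ of $\{\pm1,\dots,\pm n\}$ with $\sigma(-k)=-\sigma(k)$, generated by $\pi_0=(1,-1)$ and $\pi_i=(i,i+1)$, $1\le i\le n-1$ (each $\pi_i$ also exchanging $-i$ and $-(i+1)$). It acts on $H^{\otimes n}$: $\pi_0$ replaces the first factor $x_1$ by $\overline{x_1}$ and $\pi_i$ exchanges the factors $i$ and $i+1$. For $\sigma\in\Sigma(n)$ let $l_1(\sigma)$ and $l_2(\sigma)$ be the numbers of occurrences of $\pi_0$ and of $\pi_1,\dots,\pi_{n-1}$, respectively, in a shortest expression of $\sigma$ in the generators. For real $\alpha,q$ put, with $0^0=1$, $$P^{(n)}_{\alpha,q}=\sum_{\sigma\in\Sigma(n)}\alpha^{l_1(\sigma)}q^{l_2(\sigma)}\sigma\quad(n\ge1),\qquad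 P^{(0)}_{\alpha,q}=\mathrm{id}.$$ On the algebraic Fock space $\mathcal F=\bigoplus_{n\ge0}H^{\otimes n}$, $H^{\otimes0}=\mathbb C\Omega$, let $\langle f,g\rangle_{\alpha,q}=\sum_n\langle f_n,P^{(n)}_{\alpha,q}g_n\rangle_{0,0}$, where $\langle x_1\otimes\cdots\otimes x_n,y_1\otimes\cdots\otimes y_n\rangle_{0,0}=\prod_i\langle x_i,y_i\rangle$. Let $B^*(x)$ be the creation operator $x_1\otimes\cdots\otimes x_n\mapsto x_1\otimes\cdots\otimes x_n\otimes x$, let $B_{\alpha,q}(x)$ be its adjoint on $\mathcal F$ with respect to $\langle\cdot,\cdot\rangle_{\alpha,q}$, and put $G_{\alpha,q}(x)=B_{\alpha,q}(x)+B^*(x)$. Let $\mathcal P_2(2m)$ be the set of pair partitions of $\{1,\dots,2m\}$. For $\pi\in\mathcal P_2(2m)$ let $\mathrm{Cr}(\pi)$ be the number of crossings, i.e. of sets $\{V,W\}\subset\pi$ of two blocks for which there are $i,j\in V$ and $k,l\in W$ with $i<k<j<l$. Let $\mathcal{NC}_2(2m)=\{\pi\in\mathcal P_2(2m):\mathrm{Cr}(\pi)=0\}$.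 Let $\mathrm{In}(\pi)$ be the number of inner blocks, i.e. of blocks $V$ such that some block $W$ contains $i,j$ with $i<k<j$ for all $k\in V$. In products over blocks $\{i,j\}\in\pi$ we write $i<j$. **Corollary.** Let $m\ge0$ and let $x_1,\dots,x_{2m}\in H_{\mathbb R}$ satisfy $\overline{x_i}=x_i$ for all $i$. 1. Let $\alpha=0$ and $-1<q<1$. The adjoints $B_{0,q}(x)$, $x\in H$, exist, and $$\langle\Omega,G_{0,q}(x_1)\cdots G_{0,q}(x_{2m})\Omega\rangle_{0,q}=\sum_{\pi\in\mathcal P_2(2m)}q^{\mathrm{Cr}(\pi)}\prod_{\{i,j\}\in\pi}\langle x_i,x_j\rangle .$$ 2. Let $q=0$, $\alpha\in(-1,\infty)$, $t=1/(1+\alpha)$, so that $t\in(0,\infty)$ and $\alpha=(1-t)/t$. For $n\ge1$ one has $P^{(n)}_{\alpha,0}=1+\alpha\pi_0$. With respect to $\langle\cdot,\cdot\rangle_{0,0}$ this operator is strictly positive on $H^{\otimes n}$ if $\alpha<1$, and for every $\alpha>-1$ it is strictly positive on the span of the tensors $y_1\otimes\cdots\otimes y_n$ with $\overline{y_i}=y_i$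 for all $i$ (hence on all of $H^{\otimes n}$ if the involution is the identity). Here $P$ is strictly positive on a subspace if $\langle\xi,P\xi\rangle_{0,0}>0$ for every $\xi\ne0$ in it. The adjoints $B_{\alpha,0}(x)$, $x\in H$, exist, and the operators $\tilde G_t(x)=\sqrt t\,G_{\alpha,0}(x)$ satisfy $$\langle\Omega,\tilde G_t(x_1)\cdots\tilde G_t(x_{2m})\Omega\rangle_{\alpha,0}=\sum_{\pi\in\mathcal{NC}_2(2m)}t^{\mathrm{In}(\pi)}\prod_{\{i,j\}\in\pi}\langle x_i,x_j\rangle .$$ (In the case $\alpha=1$ of part 2 the form can be degenerate; then $B_{1,0}(x)$ denotes an arbitrarily fixed adjoint.) -/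

import Mathlib

open scoped TensorProduct DirectSum ComplexOrder

noncomputable section

namespace TypeBFock

/-! ### The Coxeter group of type B -/

/-- The `2n` points `±1, …, ±n`: the pair `(k, s)` stands for `s · (k + 1)`. -/
abbrev SignedPoint (n : ℕ) : Type := Fin n × ℤˣ

/-- `Σ(n)`: the bijections `σ` of the signed points such that `σ(-p) = -σ(p)`, under composition. -/
def typeBGroup (n : ℕ) : Subgroup (Equiv.Perm (SignedPoint n)) where
  carrier := {σ | ∀ (k : Fin n) (s : ℤˣ), σ (k, -s) = ((σ (k, s)).1, -(σ (k, s)).2)}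
  one_mem' := fun _ _ => rfl
  mul_mem' := by
    intro σ τ hσ hτ k s
    rw [Equiv.Perm.mul_apply, Equiv.Perm.mul_apply, hτ k s]
    exact hσ _ _
  inv_mem' := by
    intro σ hσ k s
    rw [Equiv.Perm.inv_eq_iff_eq, hσ, Prod.mk.eta]
    simp

instance (n : ℕ) : Fintype (typeBGroup n) := Fintype.ofFinite _

/-- The generators: `gen 0 = π₀` exchanges the points `1` and `-1`, and for `i ≥ 1`, `gen i = π_i`
exchanges `i` with `i + 1` and `-i` with `-(i + 1)`. -/
def gen {n : ℕ} (i : Fin n) : Equiv.Perm (SignedPoint n) :=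
  if i.val = 0 then Equiv.swap (i, 1) (i, -1)
  else Equiv.prodCongr (Equiv.swap ⟨i.val - 1, by omega⟩ i) (Equiv.refl ℤˣ)

/-- `w` is an irreducible (shortest) expression `σ = π_{i₁} ⋯ π_{i_k}`. -/
def IsReducedWord {n : ℕ} (w : List (Fin n)) (σ : Equiv.Perm (SignedPoint n)) : Prop :=
  (w.map gen).prod = σ ∧ ∀ v : List (Fin n), (v.map gen).prod = σ → w.length ≤ v.length

/-- The number of `π₀` in an irreducible expression of `σ`. It does not depend on the
expression, so that the infimum is over a one-element set. -/
def l₁ {n : ℕ} (σ : Equiv.Perm (SignedPoint n)) : ℕ :=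
  sInf {c | ∃ w : List (Fin n), IsReducedWord w σ ∧ w.countP (fun i => i.val = 0) = c}

/-- The number of `π_i`, `i ≥ 1`, in an irreducible expression of `σ`. It does not depend on the
expression, so that the infimum is over a one-element set. -/
def l₂ {n : ℕ} (σ : Equiv.Perm (SignedPoint n)) : ℕ :=
  sInf {c | ∃ w : List (Fin n), IsReducedWord w σ ∧ w.countP (fun i => i.val ≠ 0) = c}

/-- The permutation `k ↦ |σ(k)|` of `1, …, n` (applied to `σ⁻¹` it is the inverse permutation). -/
def absFun {n : ℕ} (σ : Equiv.Perm (SignedPoint n)) (k : Fin n) : Fin n := (σ (k, 1)).1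

theorem absFun_leftInverse {n : ℕ} {σ : Equiv.Perm (SignedPoint n)} (hσ : σ ∈ typeBGroup n) :
    Function.LeftInverse (absFun σ⁻¹) (absFun σ) := by
  intro k
  have h : ∀ s : ℤˣ, (σ⁻¹ ((σ (k, 1)).1, s)).1 = k := by
    intro s
    rcases Int.units_eq_one_or ((σ (k, 1)).2 * s) with h | h
    · have hs : s = (σ (k, 1)).2 := by
        rcases Int.units_eq_one_or s with h1 | h1 <;>
          rcases Int.units_eq_one_or (σ (k, 1)).2 with h2 | h2 <;> simp_all
      rw [hs, Prod.mk.eta]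
      simp
    · have hs : s = -(σ (k, 1)).2 := by
        rcases Int.units_eq_one_or s with h1 | h1 <;>
          rcases Int.units_eq_one_or (σ (k, 1)).2 with h2 | h2 <;> simp_all
      rw [hs, ← hσ k 1]
      simp
  exact h 1

/-- The permutation `k ↦ |σ(k)|` of `1, …, n`. -/
def absPerm {n : ℕ} (σ : typeBGroup n) : Equiv.Perm (Fin n) where
  toFun := absFun σ.1
  invFun := absFun σ.1⁻¹
  left_inv := absFun_leftInverse σ.2
  right_inv := by
    have h := absFun_leftInverse ((typeBGroup n).inv_mem σ.2)
    rwa [inv_inv] at h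

variable {H : Type*} [NormedAddCommGroup H] [InnerProductSpace ℂ H]

/-- `HR` is a real form of `H`, i.e. `H` is the complexification of the real inner product
space `HR`. -/
structure IsRealForm (HR : Submodule ℝ H) : Prop where
  inner_real : ∀ x ∈ HR, ∀ y ∈ HR, (inner ℂ x y).im = 0
  span : ∀ z : H, ∃ x ∈ HR, ∃ y ∈ HR, z = x + Complex.I • y

/-! ### The action on tensor powers and the type B symmetrization operator -/

/-- The action of `σ ∈ Σ(n)` on `H^{⊗n}`: the `j`-th factor of `σ(x₁ ⊗ ⋯ ⊗ x_n)` is `x_k` if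
`σ⁻¹(j) = k` and `J x_k` if `σ⁻¹(j) = -k`, where `J` is the involution of `H`. -/
def action (J : H →ₗ[ℂ] H) {n : ℕ} (σ : typeBGroup n) : (⨂[ℂ]^n H) →ₗ[ℂ] (⨂[ℂ]^n H) :=
  PiTensorProduct.map (fun j : Fin n => if (σ.1⁻¹ (j, 1)).2 = 1 then LinearMap.id else J) ∘ₗ
    (PiTensorProduct.reindex ℂ (fun _ : Fin n => H) (absPerm σ)).toLinearMap

theorem action_tprod (J : H →ₗ[ℂ] H) {n : ℕ} (σ : typeBGroup n) (x : Fin n → H) :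
    action J σ (PiTensorProduct.tprod ℂ x) = PiTensorProduct.tprod ℂ (fun j : Fin n =>
      if (σ.1⁻¹ (j, 1)).2 = 1 then x (σ.1⁻¹ (j, 1)).1 else J (x (σ.1⁻¹ (j, 1)).1)) := by
  rw [action, LinearMap.comp_apply, LinearEquiv.coe_coe, PiTensorProduct.reindex_tprod,
    PiTensorProduct.map_tprod]
  congr 1
  funext j
  split_ifs <;> rfl

/-- The operator `π₀` on `H^{⊗n}`, `n ≥ 1`: it applies `J` to the first factor. -/
def firstInvolution (J : H →ₗ[ℂ] H) (n : ℕ) : (⨂[ℂ]^n H) →ₗ[ℂ] (⨂[ℂ]^n H) :=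
  PiTensorProduct.map (fun j : Fin n => if j.val = 0 then J else LinearMap.id)

/-- The type B symmetrization operator `P_{α,q}^{(n)}` on `H^{⊗n}`, with `0 ^ 0 = 1`.
For `n = 0` it is the identity. -/
def symmetrizer (α q : ℝ) (J : H →ₗ[ℂ] H) (n : ℕ) : (⨂[ℂ]^n H) →ₗ[ℂ] (⨂[ℂ]^n H) :=
  ∑ σ : typeBGroup n, ((α : ℂ) ^ l₁ σ.1 * (q : ℂ) ^ l₂ σ.1) • action J σ

/-! ### The free inner product on tensor powers -/

/-- The linear functional `y₁ ⊗ ⋯ ⊗ y_n ↦ ∏ ⟨x_i, y_i⟩`. -/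
def innerFunctional {n : ℕ} (x : Fin n → H) : (⨂[ℂ]^n H) →ₗ[ℂ] ℂ :=
  PiTensorProduct.lift
    ((MultilinearMap.mkPiAlgebra ℂ (Fin n) ℂ).compLinearMap fun i => (innerₛₗ ℂ (x i)))

theorem innerFunctional_tprod {n : ℕ} (x y : Fin n → H) :
    innerFunctional x (PiTensorProduct.tprod ℂ y) = ∏ i, inner ℂ (x i) (y i) := by
  simp [innerFunctional]

/-- The antilinear functional `x₁ ⊗ ⋯ ⊗ x_n ↦ ∏ ⟨x_i, y_i⟩`. -/
def innerAntifunctional {n : ℕ} (y : Fin n → H) : (⨂[ℂ]^n H) →ₗ⋆[ℂ] ℂ :=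
  (starLinearEquiv ℂ (A := ℂ)).toLinearMap.comp (innerFunctional y)

theorem innerAntifunctional_tprod {n : ℕ} (x y : Fin n → H) :
    innerAntifunctional y (PiTensorProduct.tprod ℂ x) = ∏ i, inner ℂ (x i) (y i) := by
  simp [innerAntifunctional, innerFunctional_tprod]

theorem antilinear_ext {n : ℕ} {f g : (⨂[ℂ]^n H) →ₗ⋆[ℂ] ℂ}
    (h : ∀ x : Fin n → H, f (PiTensorProduct.tprod ℂ x) = g (PiTensorProduct.tprod ℂ x)) :
    f = g := by
  ext ξ
  induction ξ using PiTensorProduct.induction_on with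
  | smul_tprod r x => rw [map_smulₛₗ, map_smulₛₗ, h]
  | add a b ha hb => rw [map_add, map_add, ha, hb]

/-- The inner product `⟨·,·⟩_{0,0}` on `H^{⊗n}`, antilinear on the left and linear on the right. -/
def tensorInner (n : ℕ) : (⨂[ℂ]^n H) →ₗ⋆[ℂ] (⨂[ℂ]^n H) →ₗ[ℂ] ℂ :=
  (PiTensorProduct.lift
    { toFun := fun y : Fin n → H => innerAntifunctional y
      map_update_add' := by
        intro _ y i a b
        refine antilinear_ext fun x => ?_
        simp only [LinearMap.add_apply, innerAntifunctional_tprod]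
        rw [← Finset.mul_prod_erase _ _ (Finset.mem_univ i),
          ← Finset.mul_prod_erase _ _ (Finset.mem_univ i),
          ← Finset.mul_prod_erase _ _ (Finset.mem_univ i)]
        simp only [Function.update_self, inner_add_right, add_mul]
        congr 1 <;> congr 1 <;> refine Finset.prod_congr rfl fun j hj => ?_ <;>
          simp [Function.update_of_ne (Finset.ne_of_mem_erase hj)]
      map_update_smul' := by
        intro _ y i c a
        refine antilinear_ext fun x => ?_
        simp only [LinearMap.smul_apply, innerAntifunctional_tprod]
        rw [← Finset.mul_prod_erase _ _ (Finset.mem_univ i),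
          ← Finset.mul_prod_erase _ _ (Finset.mem_univ i)]
        simp only [Function.update_self, inner_smul_right, smul_eq_mul, mul_assoc]
        congr 2
        refine Finset.prod_congr rfl fun j hj => ?_
        simp [Function.update_of_ne (Finset.ne_of_mem_erase hj)] }).flip

theorem tensorInner_tprod {n : ℕ} (x y : Fin n → H) :
    tensorInner n (PiTensorProduct.tprod ℂ x) (PiTensorProduct.tprod ℂ y) =
      ∏ i, inner ℂ (x i) (y i) := by
  rw [tensorInner, LinearMap.flip_apply, PiTensorProduct.lift.tprod]
  exact innerAntifunctional_tprod x y

/-! ### The Fock space -/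

variable (H) in
/-- The algebraic full Fock space `⨁ₙ H^{⊗n}`; its multiplication is the tensor product. -/
abbrev Fock : Type _ := ⨁ n : ℕ, ⨂[ℂ]^n H

variable (H) in
/-- The vacuum vector, the empty tensor product in `H^{⊗0}`. -/
def vacuum : Fock H :=
  DirectSum.lof ℂ ℕ (fun n => ⨂[ℂ]^n H) 0 (PiTensorProduct.tprod ℂ Fin.elim0)

/-- The deformed form `⟨f, g⟩_{α,q} = ∑ₙ ⟨fₙ, P_{α,q}^{(n)} gₙ⟩_{0,0}`. -/
def fockForm (α q : ℝ) (J : H →ₗ[ℂ] H) (f g : Fock H) : ℂ :=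
  DirectSum.toModule ℂ ℕ ℂ (fun n => tensorInner n (f n) ∘ₗ symmetrizer α q J n) g

/-- The creation operator `x₁ ⊗ ⋯ ⊗ x_n ↦ x₁ ⊗ ⋯ ⊗ x_n ⊗ x`. -/
def creation (x : H) : Module.End ℂ (Fock H) :=
  LinearMap.mulRight ℂ
    (DirectSum.lof ℂ ℕ (fun n => ⨂[ℂ]^n H) 1 (PiTensorProduct.tprod ℂ fun _ => x))

/-- `S` is an adjoint of `T` with respect to `⟨·,·⟩_{α,q}`. -/
def IsFockAdjoint (α q : ℝ) (J : H →ₗ[ℂ] H) (T S : Module.End ℂ (Fock H)) : Prop :=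
  ∀ f g : Fock H, fockForm α q J (T f) g = fockForm α q J f (S g)

open Classical in
/-- The annihilation operator: the adjoint of `creation x` with respect to `⟨·,·⟩_{α,q}`. -/
def annihilation (α q : ℝ) (J : H →ₗ[ℂ] H) (x : H) : Module.End ℂ (Fock H) :=
  if h : ∃ S, IsFockAdjoint α q J (creation x) S then h.choose else 0

/-- The Gaussian operator `G_{α,q}(x)`. -/
def gaussian (α q : ℝ) (J : H →ₗ[ℂ] H) (x : H) : Module.End ℂ (Fock H) :=
  annihilation α q J x + creation x

/-! ### Pair partitions and their statistics -/

open Classical in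
/-- The set of pair partitions of an `n`-element ordered set. -/
def pairPartitions (n : ℕ) : Finset (Finpartition (Finset.univ : Finset (Fin n))) :=
  Finset.univ.filter fun π => ∀ V ∈ π.parts, V.card = 2

open Classical in
/-- The number of crossings: of the sets `{V, W}` of two blocks with `i, j ∈ V`, `k, l ∈ W` and
`i < k < j < l` for some `i, j, k, l`. -/
def crossings {n : ℕ} (π : Finpartition (Finset.univ : Finset (Fin n))) : ℕ :=
  ((π.parts.powersetCard 2).filter fun S => ∃ V ∈ S, ∃ W ∈ S, V ≠ W ∧
    ∃ i ∈ V, ∃ j ∈ V, ∃ k ∈ W, ∃ l ∈ W, i < k ∧ k < j ∧ j < l).card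

/-- The set of noncrossing pair partitions. -/
def noncrossingPairPartitions (n : ℕ) : Finset (Finpartition (Finset.univ : Finset (Fin n))) :=
  (pairPartitions n).filter fun π => crossings π = 0

/-- The block `W` covers the block `V`. -/
def Covers {n : ℕ} (W V : Finset (Fin n)) : Prop :=
  ∃ i ∈ W, ∃ j ∈ W, ∀ k ∈ V, i < k ∧ k < j

open Classical in
/-- The number of inner blocks, i.e. of blocks covered by some block. -/
def innerBlocks {n : ℕ} (π : Finpartition (Finset.univ : Finset (Fin n))) : ℕ :=
  (π.parts.filter fun V => ∃ W ∈ π.parts, Covers W V).card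

/-- `∏ ⟨x_i, x_j⟩` over the blocks `{i, j}` of the pair partition `π`, written with `i < j`. -/
def pairProduct {n : ℕ} (π : Finpartition (Finset.univ : Finset (Fin n))) (x : Fin n → H) : ℂ :=
  ∏ p : Fin n × Fin n with p.1 < p.2 ∧ {p.1, p.2} ∈ π.parts, inner ℂ (x p.1) (x p.2)

end TypeBFock

end

noncomputable section

namespace TypeBFock

variable {H : Type*} [NormedAddCommGroup H] [InnerProductSpace ℂ H]

/-! The sum over the Coxeter group collapses in both cases. The weight `0 ^ l₁` keeps exactly the
elements without sign changes, on which `l₂` counts inversions; the weight `0 ^ l₂` keeps only 1 and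
π₀. So P_{0,q} is the q-symmetrizer of the symmetric group and P_{α,0} = 1 + απ₀
(`symmetrizer_zero_left_tprod`, `symmetrizer_zero_right_succ`). Positivity of the latter is read off
the eigenvalues 1 ± α, of which only 1 + α occurs on tensors of J-fixed vectors.

In both cases an adjoint of creation can be written down: `annihilate` contracts each factor with
weight q to the number of factors on its right, with an extra term α⟨Jy, x⟩ in degree one
(`isFockAdjoint_annihilate`). The form may be degenerate, so the adjoint chosen in `annihilation`
need not be this one. Two adjoints differ by a map into the radical, and creation and its adjoints
preserve the radical, so the moments may be computed with `annihilate`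
(`prod_gaussian_sub_mem_radical`).

In the product G(x_0)⋯G(x_{n-1})Ω the rightmost factor acts first. When the turn of j comes, the
vector is a combination of tensors indexed by sets s of points above j that are still open. G(x_j)
either opens j or closes some k in s, creating the pair (j, k). Later operators will close the
points of s below k by pairs crossing (j, k), and those above k by pairs covering it. Hence closing
k contributes q for each element of s below k, and (j, k) is inner exactly if s has an element above
k.

For q = 0 only k = min s can be closed, with coefficient 1 + α if s = {k} and 1 otherwise. Rescaling
by t = 1/(1 + α) turns these into 1 for an outer and t for an inner pair (`weight_eq`). Since αq =
0, one argument gives the weight q^Cr t^In in both cases (`annihilate_setTensor`,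
`sum_openMatchings_of_recursion`, `fockForm_vacuum_prod_gaussian`); then t = 1 or q = 0 is inserted.
-/

/-! ### Inversions of permutations -/

/-- The number of inversions of a permutation. -/
def inversions {n : ℕ} (τ : Equiv.Perm (Fin n)) : ℕ :=
  (Finset.univ.filter fun p : Fin n × Fin n => p.1 < p.2 ∧ τ p.2 < τ p.1).card

/-- An adjacent transposition preserves the order of every pair of places except (i, j) itself.
Applying it to both entries therefore carries the old inversions to the new ones, and (i, j) is the
only additional one. -/
theorem inversions_mul_swap {n : ℕ} (τ : Equiv.Perm (Fin n)) {i j : Fin n}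
    (hij : j.val = i.val + 1) (h : τ i < τ j) :
    inversions (τ * Equiv.swap i j) = inversions τ + 1 := by
  classical
  have hlt : i < j := by rw [Fin.lt_def]; omega
  have key : (Finset.univ.filter fun p : Fin n × Fin n =>
      p.1 < p.2 ∧ (τ * Equiv.swap i j) p.2 < (τ * Equiv.swap i j) p.1) =
      insert (i, j) ((Finset.univ.filter fun p : Fin n × Fin n => p.1 < p.2 ∧ τ p.2 < τ p.1).map
        ((Equiv.swap i j).prodCongr (Equiv.swap i j)).toEmbedding) := by
    ext ⟨a, b⟩
    rw [Finset.mem_insert, Finset.mem_map_equiv]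
    simp only [Finset.mem_filter, Finset.mem_univ, true_and, Equiv.Perm.mul_apply,
      Equiv.prodCongr_symm, Equiv.symm_swap, Equiv.prodCongr_apply, Prod.map_apply,
      Prod.mk.injEq]
    simp only [Equiv.swap_apply_def]
    -- No place lies strictly between i and j, so any other place compares in the same way with
    -- both.
    have h1 : a ≠ i → a ≠ j → (a < i ↔ a < j) := by grind
    have h2 : b ≠ i → b ≠ j → (i < b ↔ j < b) := by grind
    grind
  rw [inversions, key, Finset.card_insert_of_notMem, Finset.card_map, inversions]
  rw [Finset.mem_map_equiv]
  simp only [Finset.mem_filter, Finset.mem_univ, true_and, Equiv.prodCongr_symm, Equiv.symm_swap,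
    Equiv.prodCongr_apply, Prod.map_apply, Equiv.swap_apply_left, Equiv.swap_apply_right]
  exact fun h' => lt_asymm h'.1 hlt

theorem inversions_mul_swap_of_gt {n : ℕ} (τ : Equiv.Perm (Fin n)) {i j : Fin n}
    (hij : j.val = i.val + 1) (h : τ j < τ i) :
    inversions (τ * Equiv.swap i j) + 1 = inversions τ := by
  have := inversions_mul_swap (τ * Equiv.swap i j) hij (by simpa using h)
  rw [← this, mul_assoc, Equiv.swap_mul_self, mul_one]

theorem inversions_mul_swap_le {n : ℕ} (τ : Equiv.Perm (Fin n)) {i j : Fin n}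
    (hij : j.val = i.val + 1) : inversions (τ * Equiv.swap i j) ≤ inversions τ + 1 := by
  rcases lt_trichotomy (τ i) (τ j) with h | h | h
  · exact (inversions_mul_swap τ hij h).le
  · have := τ.injective h
    subst this
    omega
  · have := inversions_mul_swap_of_gt τ hij h
    omega

theorem eq_one_or_exists_descent {n : ℕ} (τ : Equiv.Perm (Fin n)) :
    τ = 1 ∨ ∃ i j : Fin n, j.val = i.val + 1 ∧ τ j < τ i := by
  rcases n with _ | n
  · exact Or.inl (Subsingleton.elim _ _)
  by_contra! hcon
  obtain ⟨hne, hcon⟩ := hcon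
  apply hne
  have hmono : StrictMono τ := by
    rw [Fin.strictMono_iff_lt_succ]
    intro i
    refine lt_of_le_of_ne (hcon i.castSucc i.succ (by simp)) fun h => ?_
    exact (Fin.castSucc_lt_succ (i := i)).ne (τ.injective h)
  ext1 i
  have := (StrictMono.range_inj hmono (strictMono_id (α := Fin (n + 1)))).mp
    (by rw [τ.surjective.range_eq, Set.range_id])
  exact congrFun this i

theorem inversions_one (n : ℕ) : inversions (1 : Equiv.Perm (Fin n)) = 0 := by
  rw [inversions, Finset.card_eq_zero, Finset.filter_eq_empty_iff]
  rintro ⟨a, b⟩ - ⟨h, h'⟩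
  exact lt_asymm h h'

theorem inversions_inv {n : ℕ} (τ : Equiv.Perm (Fin n)) : inversions τ⁻¹ = inversions τ := by
  refine Finset.card_bij' (fun p _ => (τ⁻¹ p.2, τ⁻¹ p.1)) (fun p _ => (τ p.2, τ p.1)) ?_ ?_ ?_ ?_
  · rintro ⟨a, b⟩ h
    simpa [and_comm] using h
  · rintro ⟨a, b⟩ h
    simpa [and_comm] using h
  · rintro ⟨a, b⟩ -
    simp
  · rintro ⟨a, b⟩ -
    simp

/-! ### Expressions of elements of the Coxeter group -/

/-- The signed permutation without sign changes which a permutation defines. -/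
def unsigned {n : ℕ} (τ : Equiv.Perm (Fin n)) : Equiv.Perm (SignedPoint n) :=
  Equiv.prodCongr τ (Equiv.refl ℤˣ)

theorem unsigned_apply {n : ℕ} (τ : Equiv.Perm (Fin n)) (k : Fin n) (s : ℤˣ) :
    unsigned τ (k, s) = (τ k, s) := rfl

theorem unsigned_mul {n : ℕ} (τ τ' : Equiv.Perm (Fin n)) :
    unsigned (τ * τ') = unsigned τ * unsigned τ' := rfl

theorem unsigned_one (n : ℕ) : unsigned (1 : Equiv.Perm (Fin n)) = 1 := rfl

theorem unsigned_inv {n : ℕ} (τ : Equiv.Perm (Fin n)) : (unsigned τ)⁻¹ = unsigned τ⁻¹ := rfl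

theorem unsigned_injective (n : ℕ) : Function.Injective (unsigned (n := n)) := by
  intro τ τ' h
  ext1 k
  exact congrArg (fun σ : Equiv.Perm (SignedPoint n) => (σ (k, 1)).1) h

theorem unsigned_mem {n : ℕ} (τ : Equiv.Perm (Fin n)) : unsigned τ ∈ typeBGroup n :=
  fun _ _ => rfl

theorem gen_of_ne {n : ℕ} {i j : Fin n} (h : j.val = i.val + 1) :
    gen j = unsigned (Equiv.swap i j) := by
  have hj : j.val ≠ 0 := by omega
  have : (⟨j.val - 1, by omega⟩ : Fin n) = i := Fin.ext (by simp; omega)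
  rw [gen, if_neg hj, this]
  rfl

theorem gen_of_ne' {n : ℕ} {j : Fin n} (h : j.val ≠ 0) :
    ∃ i : Fin n, j.val = i.val + 1 ∧ gen j = unsigned (Equiv.swap i j) :=
  ⟨⟨j.val - 1, by omega⟩, by simp; omega, gen_of_ne (by simp; omega)⟩

theorem gen_of_eq {n : ℕ} {j : Fin n} (h : j.val = 0) :
    gen j = Equiv.swap (j, (1 : ℤˣ)) (j, -1) := by
  rw [gen, if_pos h]

theorem gen_mul_self {n : ℕ} (i : Fin n) : gen i * gen i = 1 := by
  by_cases h : i.val = 0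
  · rw [gen_of_eq h, Equiv.swap_mul_self]
  · obtain ⟨j, -, hj⟩ := gen_of_ne' h
    rw [hj, ← unsigned_mul, Equiv.swap_mul_self, unsigned_one]

theorem gen_inv {n : ℕ} (i : Fin n) : (gen i)⁻¹ = gen i :=
  inv_eq_of_mul_eq_one_left (gen_mul_self i)

theorem swap_sign_apply {n : ℕ} (j k : Fin n) (s : ℤˣ) :
    Equiv.swap (j, (1 : ℤˣ)) (j, -1) (k, s) = (k, if k = j then -s else s) := by
  by_cases h : k = j
  · subst h
    rcases Int.units_eq_one_or s with rfl | rfl <;> simp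
  · rw [Equiv.swap_apply_of_ne_of_ne] <;> simp [h]

theorem swap_sign_mem {n : ℕ} (j : Fin n) :
    Equiv.swap (j, (1 : ℤˣ)) (j, -1) ∈ typeBGroup n := by
  intro k s
  rw [swap_sign_apply, swap_sign_apply]
  split_ifs <;> rfl

/-- Bubble sort: each adjacent transposition at a descent removes one inversion. -/
theorem exists_word_unsigned {n : ℕ} (τ : Equiv.Perm (Fin n)) :
    ∃ w : List (Fin n), (w.map gen).prod = unsigned τ ∧ w.length = inversions τ := by
  induction h : inversions τ generalizing τ with
  | zero =>
    rcases eq_one_or_exists_descent τ with rfl | ⟨i, j, hij, hlt⟩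
    · exact ⟨[], rfl, rfl⟩
    · have := inversions_mul_swap_of_gt τ hij hlt
      omega
  | succ k ih =>
    rcases eq_one_or_exists_descent τ with rfl | ⟨i, j, hij, hlt⟩
    · rw [inversions_one] at h
      omega
    · have := inversions_mul_swap_of_gt τ hij hlt
      obtain ⟨w, hw, hl⟩ := ih (τ * Equiv.swap i j) (by omega)
      refine ⟨w ++ [j], ?_, by simp [hl]⟩
      rw [List.map_append, List.prod_append, hw, List.map_singleton, List.prod_singleton,
        gen_of_ne hij, ← unsigned_mul, mul_assoc, Equiv.swap_mul_self, mul_one]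

/-- After forgetting signs π₀ becomes trivial, and every other generator changes the number of
inversions by at most one. This is the lower bound matching `exists_word_unsigned`. -/
theorem inversions_le_countP {n : ℕ} (w : List (Fin n)) :
    ∃ τ : Equiv.Perm (Fin n), (∀ k s, ((w.map gen).prod (k, s)).1 = τ k) ∧
      inversions τ ≤ w.countP (fun i => i.val ≠ 0) := by
  induction w using List.reverseRecOn with
  | nil => exact ⟨1, fun _ _ => rfl, by rw [inversions_one]; exact Nat.zero_le _⟩
  | append_singleton w j ih =>
    obtain ⟨τ, hτ, hle⟩ := ih
    simp only [List.map_append, List.prod_append, List.map_singleton, List.prod_singleton,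
      List.countP_append, Equiv.Perm.mul_apply]
    by_cases h : j.val = 0
    · refine ⟨τ, fun k s => ?_, by omega⟩
      rw [gen_of_eq h, swap_sign_apply, hτ]
    · obtain ⟨i, hij, hg⟩ := gen_of_ne' h
      refine ⟨τ * Equiv.swap i j, fun k s => ?_, ?_⟩
      · rw [hg, unsigned_apply, hτ]
        rfl
      · have := inversions_mul_swap_le τ hij
        rw [List.countP_singleton, if_pos (by simpa using h)]
        omega

/-- The sign change at any k is a conjugate of π₀ by a permutation. Multiplying by such sign changes
removes the signs of σ one at a time, and a permutation remains. -/
theorem exists_word {n : ℕ} {σ : Equiv.Perm (SignedPoint n)} (hσ : σ ∈ typeBGroup n) :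
    ∃ w : List (Fin n), (w.map gen).prod = σ := by
  have hmul : ∀ σ σ' : Equiv.Perm (SignedPoint n), (∃ w : List (Fin n), (w.map gen).prod = σ) →
      (∃ w : List (Fin n), (w.map gen).prod = σ') →
      ∃ w : List (Fin n), (w.map gen).prod = σ * σ' := by
    rintro σ σ' ⟨w, rfl⟩ ⟨w', rfl⟩
    exact ⟨w ++ w', by simp⟩
  have huns : ∀ τ : Equiv.Perm (Fin n), ∃ w : List (Fin n), (w.map gen).prod = unsigned τ :=
    fun τ => (exists_word_unsigned τ).imp fun w hw => hw.1
  have hflip : ∀ k : Fin n, ∃ w : List (Fin n),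
      (w.map gen).prod = Equiv.swap (k, (1 : ℤˣ)) (k, -1) := by
    intro k
    let z : Fin n := ⟨0, k.pos⟩
    have hz : ∃ w : List (Fin n), (w.map gen).prod = Equiv.swap (z, (1 : ℤˣ)) (z, -1) :=
      ⟨[z], by rw [List.map_singleton, List.prod_singleton, gen_of_eq rfl]⟩
    -- Conjugating the sign change at the first point by the transposition of this point and k.
    have h := hmul _ _ (hmul _ _ (huns (Equiv.swap z k)) hz) (huns (Equiv.swap z k)⁻¹)
    rw [← unsigned_inv, ← Equiv.swap_apply_apply, unsigned_apply, unsigned_apply,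
      Equiv.swap_apply_left] at h
    exact h
  induction h : (Finset.univ.filter fun k : Fin n => (σ (k, 1)).2 = -1).card
    generalizing σ with
  | zero =>
    rw [Finset.card_eq_zero, Finset.filter_eq_empty_iff] at h
    have : σ = unsigned (absPerm ⟨σ, hσ⟩) := by
      have h1 : ∀ k, σ (k, 1) = (absFun σ k, 1) := fun k =>
        Prod.ext rfl ((Int.units_eq_one_or _).resolve_right (h (Finset.mem_univ k)))
      ext1 ⟨k, s⟩
      rw [unsigned_apply]
      rcases Int.units_eq_one_or s with rfl | rfl
      · exact h1 k
      · rw [hσ k 1, h1]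
        rfl
    rw [this]
    exact huns _
  | succ m ih =>
    obtain ⟨k, hk⟩ := Finset.card_pos.mp (by omega : 0 < (Finset.univ.filter fun k : Fin n =>
      (σ (k, 1)).2 = -1).card)
    have hk' := (Finset.mem_filter.mp hk).2
    have hm := (typeBGroup n).mul_mem hσ (swap_sign_mem k)
    have hc : (Finset.univ.filter fun i : Fin n =>
        ((σ * Equiv.swap (k, (1 : ℤˣ)) (k, -1)) (i, 1)).2 = -1) =
        (Finset.univ.filter fun i : Fin n => (σ (i, 1)).2 = -1).erase k := by
      ext i
      simp only [Finset.mem_filter, Finset.mem_univ, true_and, Finset.mem_erase,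
        Equiv.Perm.mul_apply, swap_sign_apply]
      by_cases hi : i = k
      · subst hi
        rw [if_pos rfl, hσ, hk']
        simp
      · simp [hi]
    have := hmul _ _ (ih hm (by rw [hc, Finset.card_erase_of_mem hk, h]; rfl)) (hflip k)
    rwa [mul_assoc, Equiv.swap_mul_self, mul_one] at this

theorem exists_isReducedWord {n : ℕ} {σ : Equiv.Perm (SignedPoint n)} (hσ : σ ∈ typeBGroup n) :
    ∃ w : List (Fin n), IsReducedWord w σ := by
  classical
  have hex : ∃ k, ∃ w : List (Fin n), (w.map gen).prod = σ ∧ w.length = k := by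
    obtain ⟨w, hw⟩ := exists_word hσ
    exact ⟨_, w, hw, rfl⟩
  obtain ⟨w, hw, hl⟩ := Nat.find_spec hex
  exact ⟨w, hw, fun v hv => hl ▸ Nat.find_min' hex ⟨v, hv, rfl⟩⟩

theorem isReducedWord_reverse {n : ℕ} {w : List (Fin n)} {σ : Equiv.Perm (SignedPoint n)}
    (h : IsReducedWord w σ) : IsReducedWord w.reverse σ⁻¹ := by
  have hrev : ∀ v : List (Fin n), (v.reverse.map gen).prod = (v.map gen).prod⁻¹ := by
    intro v
    rw [List.prod_inv_reverse, List.map_reverse, List.map_map]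
    congr 3
    funext i
    exact (gen_inv i).symm
  refine ⟨by rw [hrev, h.1], fun v hv => ?_⟩
  rw [List.length_reverse, ← List.length_reverse (as := v)]
  exact h.2 _ (by rw [hrev, hv, inv_inv])

/-- Reversal turns reduced words of σ into reduced words of its inverse with the same letters. The
resulting invariance of `l₁` and `l₂` makes the symmetrizer self-adjoint. -/
theorem sInf_countP_inv {n : ℕ} (σ : Equiv.Perm (SignedPoint n)) (p : Fin n → Bool) :
    sInf {c | ∃ w : List (Fin n), IsReducedWord w σ⁻¹ ∧ w.countP p = c} =
      sInf {c | ∃ w : List (Fin n), IsReducedWord w σ ∧ w.countP p = c} := by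
  congr 1
  ext c
  constructor
  · rintro ⟨w, hw, rfl⟩
    exact ⟨w.reverse, inv_inv σ ▸ isReducedWord_reverse hw, List.countP_reverse⟩
  · rintro ⟨w, hw, rfl⟩
    exact ⟨w.reverse, isReducedWord_reverse hw, List.countP_reverse⟩

theorem l₁_inv {n : ℕ} (σ : Equiv.Perm (SignedPoint n)) : l₁ σ⁻¹ = l₁ σ := sInf_countP_inv σ _

theorem l₂_inv {n : ℕ} (σ : Equiv.Perm (SignedPoint n)) : l₂ σ⁻¹ = l₂ σ := sInf_countP_inv σ _

theorem exists_isReducedWord_l₁ {n : ℕ} {σ : Equiv.Perm (SignedPoint n)}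
    (hσ : σ ∈ typeBGroup n) :
    ∃ w : List (Fin n), IsReducedWord w σ ∧ w.countP (fun i => i.val = 0) = l₁ σ :=
  Nat.sInf_mem (s := {c | ∃ w : List (Fin n), IsReducedWord w σ ∧
    w.countP (fun i => i.val = 0) = c}) ((exists_isReducedWord hσ).elim fun w hw => ⟨_, w, hw, rfl⟩)

theorem exists_isReducedWord_l₂ {n : ℕ} {σ : Equiv.Perm (SignedPoint n)}
    (hσ : σ ∈ typeBGroup n) :
    ∃ w : List (Fin n), IsReducedWord w σ ∧ w.countP (fun i => i.val ≠ 0) = l₂ σ :=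
  Nat.sInf_mem (s := {c | ∃ w : List (Fin n), IsReducedWord w σ ∧
    w.countP (fun i => i.val ≠ 0) = c}) ((exists_isReducedWord hσ).elim fun w hw => ⟨_, w, hw, rfl⟩)

/-- Bubble sort bounds the length of w by the number of inversions, while that many letters other
than π₀ are needed already. No room for π₀ is left, whichever reduced word is taken. -/
theorem countP_of_isReducedWord_unsigned {n : ℕ} {τ : Equiv.Perm (Fin n)} {w : List (Fin n)}
    (hw : IsReducedWord w (unsigned τ)) :
    w.countP (fun i => i.val = 0) = 0 ∧ w.countP (fun i => i.val ≠ 0) = inversions τ := by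
  obtain ⟨v, hv, hl⟩ := exists_word_unsigned τ
  have h1 := hw.2 v hv
  obtain ⟨τ', hτ', hle⟩ := inversions_le_countP w
  have : τ' = τ := by
    ext1 k
    rw [← hτ' k 1, hw.1]
    rfl
  subst this
  have h2 := List.length_eq_countP_add_countP (l := w) (fun i : Fin n => decide (i.val = 0))
  have h3 : w.countP (fun i : Fin n => decide (i.val ≠ 0)) =
      w.countP (fun i : Fin n => ¬ (decide (i.val = 0)) = true) := by
    congr 1
    funext i
    simp
  omega

theorem l₁_unsigned {n : ℕ} (τ : Equiv.Perm (Fin n)) : l₁ (unsigned τ) = 0 := by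
  obtain ⟨w, hw, h⟩ := exists_isReducedWord_l₁ (unsigned_mem τ)
  rw [← h, (countP_of_isReducedWord_unsigned hw).1]

theorem l₂_unsigned {n : ℕ} (τ : Equiv.Perm (Fin n)) : l₂ (unsigned τ) = inversions τ := by
  obtain ⟨w, hw, h⟩ := exists_isReducedWord_l₂ (unsigned_mem τ)
  rw [← h, (countP_of_isReducedWord_unsigned hw).2]

theorem exists_unsigned_of_l₁_eq_zero {n : ℕ} {σ : Equiv.Perm (SignedPoint n)}
    (hσ : σ ∈ typeBGroup n) (h : l₁ σ = 0) : ∃ τ, unsigned τ = σ := by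
  obtain ⟨w, hw, hc⟩ := exists_isReducedWord_l₁ hσ
  rw [h, List.countP_eq_zero] at hc
  rw [← hw.1]
  clear hw
  induction w with
  | nil => exact ⟨1, rfl⟩
  | cons i w ih =>
    obtain ⟨τ, hτ⟩ := ih fun a ha => hc a (List.mem_cons_of_mem _ ha)
    obtain ⟨j, -, hg⟩ := gen_of_ne' (by simpa using hc i List.mem_cons_self)
    exact ⟨Equiv.swap j i * τ, by rw [unsigned_mul, hτ, ← hg, List.map_cons, List.prod_cons]⟩

theorem eq_one_or_gen_zero_of_l₂_eq_zero {n : ℕ} {σ : Equiv.Perm (SignedPoint (n + 1))}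
    (hσ : σ ∈ typeBGroup (n + 1)) (h : l₂ σ = 0) : σ = 1 ∨ σ = gen 0 := by
  obtain ⟨w, hw, hc⟩ := exists_isReducedWord_l₂ hσ
  rw [h, List.countP_eq_zero] at hc
  rw [← hw.1]
  clear hw
  induction w with
  | nil => exact Or.inl rfl
  | cons i w ih =>
    have hi : i = 0 := Fin.ext (by simpa using hc i List.mem_cons_self)
    subst hi
    rw [List.map_cons, List.prod_cons]
    rcases ih fun a ha => hc a (List.mem_cons_of_mem _ ha) with h | h
    · exact Or.inr (by rw [h, mul_one])
    · exact Or.inl (by rw [h, gen_mul_self])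

theorem gen_zero_mem (n : ℕ) : gen (0 : Fin (n + 1)) ∈ typeBGroup (n + 1) := by
  rw [gen_of_eq (Fin.val_zero _)]
  exact swap_sign_mem 0

theorem gen_zero_ne_one (n : ℕ) : gen (0 : Fin (n + 1)) ≠ 1 := by
  rw [gen_of_eq rfl, Ne, Equiv.swap_eq_one_iff]
  simp

theorem isReducedWord_gen_zero {n : ℕ} {w : List (Fin (n + 1))}
    (hw : IsReducedWord w (gen (0 : Fin (n + 1)))) : w = [0] := by
  have hl := hw.2 [0] (by simp)
  match w, hw, hl with
  | [], hw, _ => exact absurd hw.1.symm (gen_zero_ne_one n)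
  | [i], hw, _ =>
    have := hw.1
    rw [List.map_singleton, List.prod_singleton] at this
    by_cases h : i.val = 0
    · rw [show i = 0 from Fin.ext h]
    · obtain ⟨j, -, hg⟩ := gen_of_ne' h
      have h' := congrArg (fun σ : Equiv.Perm (SignedPoint (n + 1)) => (σ (0, 1)).2) this
      rw [hg, gen_of_eq rfl] at h'
      simp [unsigned_apply] at h'
  | i :: j :: w, _, hl => simp at hl

theorem l₁_gen_zero (n : ℕ) : l₁ (gen (0 : Fin (n + 1))) = 1 := by
  obtain ⟨w, hw, h⟩ := exists_isReducedWord_l₁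
    (show gen (0 : Fin (n + 1)) ∈ typeBGroup (n + 1) from gen_zero_mem n)
  rw [← h, isReducedWord_gen_zero hw]
  simp

theorem l₂_gen_zero (n : ℕ) : l₂ (gen (0 : Fin (n + 1))) = 0 := by
  obtain ⟨w, hw, h⟩ := exists_isReducedWord_l₂
    (show gen (0 : Fin (n + 1)) ∈ typeBGroup (n + 1) from gen_zero_mem n)
  rw [← h, isReducedWord_gen_zero hw]
  simp

/-! ### The symmetrizer in the cases `α = 0` and `q = 0` -/

theorem sum_inversions_inv {n : ℕ} {M : Type*} [AddCommMonoid M] (f : ℕ → Equiv.Perm (Fin n) → M) :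
    ∑ τ : Equiv.Perm (Fin n), f (inversions τ) τ⁻¹ = ∑ τ, f (inversions τ) τ :=
  Fintype.sum_equiv (Equiv.inv _) _ _ fun τ => by rw [Equiv.inv_apply, inversions_inv]

/-- The weight `0 ^ l₁` kills every element with a sign change. A permutation moves the factors by
its inverse; the sum can be reindexed since τ and its inverse have equally many inversions. -/
theorem symmetrizer_zero_left_tprod (q : ℝ) (J : H →ₗ[ℂ] H) {n : ℕ} (x : Fin n → H) :
    symmetrizer 0 q J n (PiTensorProduct.tprod ℂ x) =
      ∑ τ : Equiv.Perm (Fin n), (q : ℂ) ^ inversions τ • PiTensorProduct.tprod ℂ (x ∘ τ) := by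
  rw [← sum_inversions_inv fun k τ => (q : ℂ) ^ k • PiTensorProduct.tprod ℂ (x ∘ τ), symmetrizer,
    LinearMap.sum_apply]
  symm
  refine Finset.sum_of_injOn (fun τ => ⟨unsigned τ, unsigned_mem τ⟩) ?_ (fun _ _ => by simp) ?_ ?_
  · intro τ _ τ' _ h
    exact unsigned_injective n (congrArg Subtype.val h)
  · intro σ _ hσ
    have : l₁ σ.1 ≠ 0 := fun h => by
      obtain ⟨τ, hτ⟩ := exists_unsigned_of_l₁_eq_zero σ.2 h
      exact hσ ⟨τ, by simp, Subtype.ext hτ⟩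
    simp [this]
  · intro τ _
    rw [LinearMap.smul_apply, action_tprod, l₁_unsigned, l₂_unsigned, pow_zero, one_mul]
    congr 2

theorem action_one (J : H →ₗ[ℂ] H) (n : ℕ) : action J (1 : typeBGroup n) = LinearMap.id := by
  ext x
  simp only [LinearMap.compMultilinearMap_apply, action_tprod, OneMemClass.coe_one, inv_one,
    Equiv.Perm.one_apply, if_pos, LinearMap.id_apply]
  rfl

theorem symmetrizer_deg_zero (α q : ℝ) (J : H →ₗ[ℂ] H) : symmetrizer α q J 0 = LinearMap.id := by
  have hl₁ : l₁ (1 : Equiv.Perm (SignedPoint 0)) = 0 := l₁_unsigned (n := 0) 1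
  have hl₂ : l₂ (1 : Equiv.Perm (SignedPoint 0)) = 0 := (l₂_unsigned (n := 0) 1).trans
    (inversions_one 0)
  rw [symmetrizer, Fintype.sum_subsingleton _ 1, action_one]
  simp [hl₁, hl₂]

theorem action_gen_zero (J : H →ₗ[ℂ] H) (n : ℕ) :
    action J ⟨gen (0 : Fin (n + 1)), gen_zero_mem n⟩ = firstInvolution J (n + 1) := by
  ext x
  simp only [LinearMap.compMultilinearMap_apply, action_tprod, firstInvolution,
    PiTensorProduct.map_tprod]
  congr 1
  funext j
  rw [gen_inv, gen_of_eq (Fin.val_zero _), swap_sign_apply]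
  by_cases h : j = 0
  · subst h
    rw [if_pos rfl, if_neg (by simp), if_pos (Fin.val_zero _)]
  · have : (j : ℕ) ≠ 0 := fun h' => h (Fin.ext h')
    rw [if_neg h, if_pos rfl, if_neg this]
    rfl

theorem symmetrizer_zero_right_succ (α : ℝ) (J : H →ₗ[ℂ] H) (n : ℕ) :
    symmetrizer α 0 J (n + 1) = LinearMap.id + (α : ℂ) • firstInvolution J (n + 1) := by
  classical
  have hl₁ : l₁ (1 : Equiv.Perm (SignedPoint (n + 1))) = 0 := l₁_unsigned (n := n + 1) 1
  have hl₂ : l₂ (1 : Equiv.Perm (SignedPoint (n + 1))) = 0 := (l₂_unsigned (n := n + 1) 1).trans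
    (inversions_one _)
  have hne : (1 : typeBGroup (n + 1)) ≠ ⟨gen 0, gen_zero_mem n⟩ := fun h =>
    gen_zero_ne_one n (congrArg Subtype.val h).symm
  rw [symmetrizer, ← Finset.sum_subset (Finset.subset_univ {1, ⟨gen 0, gen_zero_mem n⟩}),
    Finset.sum_pair hne, action_one, action_gen_zero]
  · simp [hl₁, hl₂, l₁_gen_zero, l₂_gen_zero]
  · intro σ _ hσ
    have : l₂ σ.1 ≠ 0 := fun h => by
      rcases eq_one_or_gen_zero_of_l₂_eq_zero σ.2 h with h | h
      · exact hσ (by rw [Finset.mem_insert]; exact Or.inl (Subtype.ext h))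
      · exact hσ (by rw [Finset.mem_insert, Finset.mem_singleton]; exact Or.inr (Subtype.ext h))
    simp [this]

/-! ### Symmetry of the forms -/

theorem tensorInner_ext {n : ℕ} {B B' : (⨂[ℂ]^n H) →ₗ⋆[ℂ] (⨂[ℂ]^n H) →ₗ[ℂ] ℂ}
    (h : ∀ x y : Fin n → H, B (PiTensorProduct.tprod ℂ x) (PiTensorProduct.tprod ℂ y) =
      B' (PiTensorProduct.tprod ℂ x) (PiTensorProduct.tprod ℂ y)) : B = B' := by
  ext ξ y
  simp only [LinearMap.compMultilinearMap_apply]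
  induction ξ using PiTensorProduct.induction_on with
  | smul_tprod r x => rw [map_smulₛₗ, map_smulₛₗ, LinearMap.smul_apply, LinearMap.smul_apply, h]
  | add a b ha hb => rw [map_add, map_add, LinearMap.add_apply, LinearMap.add_apply, ha, hb]

theorem tensorInner_conj_symm {n : ℕ} (ξ η : ⨂[ℂ]^n H) :
    starRingEnd ℂ (tensorInner n ξ η) = tensorInner n η ξ := by
  induction ξ using PiTensorProduct.induction_on with
  | smul_tprod r x =>
    induction η using PiTensorProduct.induction_on with
    | smul_tprod s y =>
      simp only [map_smulₛₗ, LinearMap.smul_apply, tensorInner_tprod, smul_eq_mul,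
        map_mul, map_prod, inner_conj_symm, RingHom.id_apply, Complex.conj_conj]
      ring
    | add a b ha hb => rw [map_add, map_add, ha, hb, map_add, LinearMap.add_apply]
  | add a b ha hb => rw [map_add, LinearMap.add_apply, map_add, ha, hb, map_add]

theorem inv_apply_of_apply {n : ℕ} (σ : typeBGroup n) {k j : Fin n} {s : ℤˣ}
    (h : σ.1 (k, 1) = (j, s)) : σ.1⁻¹ (j, 1) = (k, s) := by
  rw [Equiv.Perm.inv_eq_iff_eq]
  rcases Int.units_eq_one_or s with rfl | rfl
  · exact h.symm
  · rw [σ.2 k 1, h, neg_neg]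

/-- The group acts unitarily: reindexing the product of inner products undoes the permutation, and
each J crosses over by symmetry. -/
theorem tensorInner_action {J : H →ₗ[ℂ] H} (hJ : J.IsSymmetric) {n : ℕ} (σ : typeBGroup n)
    (ξ η : ⨂[ℂ]^n H) :
    tensorInner n (action J σ ξ) η = tensorInner n ξ (action J σ⁻¹ η) := by
  suffices h : (tensorInner n).comp (action J σ) =
      (LinearMap.lcomp ℂ ℂ (action J σ⁻¹)).comp (tensorInner n) from
    congrArg (fun B : (⨂[ℂ]^n H) →ₗ⋆[ℂ] (⨂[ℂ]^n H) →ₗ[ℂ] ℂ => B ξ η) h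
  refine tensorInner_ext fun x y => ?_
  simp only [LinearMap.comp_apply, LinearMap.lcomp_apply, action_tprod, tensorInner_tprod,
    Subgroup.coe_inv, inv_inv]
  refine (Fintype.prod_equiv (absPerm σ) _ _ fun k => ?_).symm
  have h := inv_apply_of_apply σ (k := k) (j := absPerm σ k) (s := (σ.1 (k, 1)).2) rfl
  rw [h]
  split_ifs with hs
  · rfl
  · exact (hJ _ _).symm

theorem tensorInner_symmetrizer {J : H →ₗ[ℂ] H} (hJ : J.IsSymmetric) (α q : ℝ) {n : ℕ}
    (ξ η : ⨂[ℂ]^n H) :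
    tensorInner n (symmetrizer α q J n ξ) η = tensorInner n ξ (symmetrizer α q J n η) := by
  simp only [symmetrizer, LinearMap.sum_apply, LinearMap.smul_apply, map_sum, map_smulₛₗ,
    tensorInner_action hJ]
  refine Fintype.sum_equiv (Equiv.inv _) _ _ fun σ => ?_
  simp only [Equiv.inv_apply, Subgroup.coe_inv, l₁_inv, l₂_inv, smul_eq_mul, map_mul, map_pow,
    Complex.conj_ofReal, RingHom.id_apply]

/-! ### Extending permutations by a last value -/

/-- The permutation of `Fin (n + 1)` with last value `k` whose other values are ordered as those
of `τ`. -/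
def extendPerm {n : ℕ} (k : Fin (n + 1)) (τ : Equiv.Perm (Fin n)) : Equiv.Perm (Fin (n + 1)) :=
  Equiv.ofBijective (Fin.snoc (α := fun _ => Fin (n + 1)) (fun i => k.succAbove (τ i)) k) <| by
    rw [← Finite.injective_iff_bijective]
    intro i j
    refine Fin.lastCases ?_ (fun i => ?_) i <;> refine Fin.lastCases ?_ (fun j => ?_) j
    · exact fun _ => rfl
    · intro h
      simp only [Fin.snoc_last, Fin.snoc_castSucc] at h
      exact absurd h.symm (Fin.succAbove_ne _ _)
    · intro h
      simp only [Fin.snoc_last, Fin.snoc_castSucc] at h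
      exact absurd h (Fin.succAbove_ne _ _)
    · intro h
      simp only [Fin.snoc_castSucc] at h
      rw [τ.injective (Fin.succAbove_right_injective h)]

theorem extendPerm_last {n : ℕ} (k : Fin (n + 1)) (τ : Equiv.Perm (Fin n)) :
    extendPerm k τ (Fin.last n) = k := by
  simp [extendPerm]

theorem extendPerm_castSucc {n : ℕ} (k : Fin (n + 1)) (τ : Equiv.Perm (Fin n)) (i : Fin n) :
    extendPerm k τ i.castSucc = k.succAbove (τ i) := by
  simp [extendPerm]

theorem extendPerm_bijective (n : ℕ) : Function.Bijective
    fun p : Fin (n + 1) × Equiv.Perm (Fin n) => extendPerm p.1 p.2 := by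
  rw [Fintype.bijective_iff_injective_and_card]
  refine ⟨?_, by simp [Fintype.card_perm, Nat.factorial_succ]⟩
  rintro ⟨k, τ⟩ ⟨k', τ'⟩ h
  have h1 : k = k' := by
    rw [← extendPerm_last k τ, ← extendPerm_last k' τ']
    exact Equiv.congr_fun h _
  subst h1
  refine Prod.ext rfl (Equiv.ext fun i => Fin.succAbove_right_injective (p := k) ?_)
  rw [← extendPerm_castSucc, ← extendPerm_castSucc]
  exact Equiv.congr_fun h _

theorem card_lt_succAbove {n : ℕ} (k : Fin (n + 1)) :
    (Finset.univ.filter fun j : Fin n => k < k.succAbove j).card = n - k := by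
  have : (Finset.univ.filter fun j : Fin n => k < k.succAbove j).map Fin.valEmbedding =
      Finset.Ico k.val n := by
    ext a
    simp only [Finset.mem_map, Finset.mem_filter, Finset.mem_univ, true_and, Fin.valEmbedding_apply,
      Finset.mem_Ico, Fin.lt_succAbove_iff_le_castSucc, Fin.le_def, Fin.val_castSucc]
    constructor
    · rintro ⟨j, hj, rfl⟩
      exact ⟨hj, j.2⟩
    · rintro ⟨h1, h2⟩
      exact ⟨⟨a, h2⟩, h1, rfl⟩
  rw [← Finset.card_map Fin.valEmbedding, this, Nat.card_Ico]

/-- The inversions that involve the last place correspond to the values above k, of which there are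
n - k; the others are those of τ. -/
theorem inversions_extendPerm {n : ℕ} (k : Fin (n + 1)) (τ : Equiv.Perm (Fin n)) :
    inversions (extendPerm k τ) = n - k + inversions τ := by
  have h1 : ∀ {m : ℕ} (σ : Equiv.Perm (Fin m)),
      inversions σ = ∑ i, ∑ j, if i < j ∧ σ j < σ i then 1 else 0 := by
    intro m σ
    rw [inversions, Finset.card_filter, ← Finset.univ_product_univ, Finset.sum_product]
  have h2 : (Finset.univ.filter fun i : Fin n => k < k.succAbove (τ i)).card = n - k := by
    rw [← card_lt_succAbove k, Finset.card_filter, Finset.card_filter]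
    exact Fintype.sum_equiv τ _ _ fun _ => rfl
  rw [h1, Fin.sum_univ_castSucc]
  simp only [Fin.sum_univ_castSucc, extendPerm_castSucc, extendPerm_last, Fin.castSucc_lt_castSucc_iff,
    Fin.succAbove_lt_succAbove_iff, Fin.castSucc_lt_last, true_and, lt_self_iff_false, false_and,
    if_false, add_zero, Finset.sum_add_distrib]
  rw [h1 τ, ← h2, Finset.card_filter, add_comm (∑ i, if k < k.succAbove (τ i) then 1 else 0)]
  have : ∀ i : Fin n, ¬ (Fin.last n < i.castSucc) := fun i => (Fin.le_last _).not_gt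
  simp [this]

theorem comp_extendPerm {n : ℕ} {α : Type*} (b : Fin (n + 1) → α) (k : Fin (n + 1))
    (τ : Equiv.Perm (Fin n)) :
    b ∘ extendPerm k τ = Fin.snoc (α := fun _ => α) (fun i => b (k.succAbove (τ i))) (b k) := by
  funext i
  refine Fin.lastCases ?_ (fun i => ?_) i
  · simp [extendPerm_last]
  · simp [extendPerm_castSucc]

/-! ### Contractions and the explicit annihilation operator -/

/-- The contraction `x₀ ⊗ ⋯ ⊗ x_n ↦ ⟨y, x_k⟩ x₀ ⊗ ⋯ ⊗ x_{k-1} ⊗ x_{k+1} ⊗ ⋯ ⊗ x_n`. -/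
def contract (y : H) {n : ℕ} (k : Fin (n + 1)) : (⨂[ℂ]^(n + 1) H) →ₗ[ℂ] (⨂[ℂ]^n H) :=
  PiTensorProduct.lift (LinearMap.uncurryMid k
    ((innerₛₗ ℂ y).smulRight (PiTensorProduct.tprod ℂ (s := fun _ : Fin n => H))))

theorem contract_tprod (y : H) {n : ℕ} (k : Fin (n + 1)) (x : Fin (n + 1) → H) :
    contract y k (PiTensorProduct.tprod ℂ x) =
      inner ℂ y (x k) • PiTensorProduct.tprod ℂ fun i => x (k.succAbove i) := by
  rw [contract, PiTensorProduct.lift.tprod]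
  rfl

/-- The component of degree `n + 1` of the explicit annihilation operator. -/
def annihilateSucc (α q : ℝ) (J : H →ₗ[ℂ] H) (y : H) (n : ℕ) :
    (⨂[ℂ]^(n + 1) H) →ₗ[ℂ] (⨂[ℂ]^n H) :=
  (∑ k : Fin (n + 1), (q : ℂ) ^ (n - k.val) • contract y k) +
    if n = 0 then (α : ℂ) • contract (J y) (Fin.last n) else 0

/-- An adjoint of the creation operator when `α = 0` or `q = 0`. -/
def annihilate (α q : ℝ) (J : H →ₗ[ℂ] H) (y : H) : Module.End ℂ (Fock H) :=
  DirectSum.toModule ℂ ℕ _ fun n => match n with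
    | 0 => 0
    | n + 1 => DirectSum.lof ℂ ℕ (fun n => ⨂[ℂ]^n H) n ∘ₗ annihilateSucc α q J y n

theorem annihilate_lof_zero (α q : ℝ) (J : H →ₗ[ℂ] H) (y : H) (ξ : ⨂[ℂ]^0 H) :
    annihilate α q J y (DirectSum.lof ℂ ℕ (fun n => ⨂[ℂ]^n H) 0 ξ) = 0 := by
  rw [annihilate, DirectSum.toModule_lof]
  rfl

theorem annihilate_lof_succ (α q : ℝ) (J : H →ₗ[ℂ] H) (y : H) {n : ℕ} (ξ : ⨂[ℂ]^(n + 1) H) :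
    annihilate α q J y (DirectSum.lof ℂ ℕ (fun n => ⨂[ℂ]^n H) (n + 1) ξ) =
      DirectSum.lof ℂ ℕ (fun n => ⨂[ℂ]^n H) n (annihilateSucc α q J y n ξ) := by
  rw [annihilate, DirectSum.toModule_lof]
  rfl

theorem annihilateSucc_tprod (α q : ℝ) (J : H →ₗ[ℂ] H) (y : H) {n : ℕ} (x : Fin (n + 1) → H) :
    annihilateSucc α q J y n (PiTensorProduct.tprod ℂ x) =
      (∑ k : Fin (n + 1), (q : ℂ) ^ (n - k.val) • inner ℂ y (x k) •
        PiTensorProduct.tprod ℂ fun i => x (k.succAbove i)) +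
      if n = 0 then (α : ℂ) • inner ℂ (J y) (x (Fin.last n)) •
        PiTensorProduct.tprod ℂ (fun i => x ((Fin.last n).succAbove i)) else 0 := by
  rw [annihilateSucc, LinearMap.add_apply, LinearMap.sum_apply]
  simp only [LinearMap.smul_apply, contract_tprod]
  split_ifs
  · rw [LinearMap.smul_apply, contract_tprod]
  · rfl

theorem tensorInner_snoc {n : ℕ} (a b : Fin n → H) (x y : H) :
    tensorInner (n + 1) (PiTensorProduct.tprod ℂ (Fin.snoc (α := fun _ => H) a x))
      (PiTensorProduct.tprod ℂ (Fin.snoc (α := fun _ => H) b y)) =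
      inner ℂ x y * tensorInner n (PiTensorProduct.tprod ℂ a) (PiTensorProduct.tprod ℂ b) := by
  rw [tensorInner_tprod, tensorInner_tprod, Fin.prod_univ_castSucc]
  simp [mul_comm]

/-- The permutations of n + 1 places are sorted by their value k at the last place. This value
selects the factor paired with y, and the n - k inversions it causes give the weight of the
contraction. -/
theorem tensorInner_snoc_symmetrizer_zero_left (q : ℝ) (J : H →ₗ[ℂ] H) (y : H) {n : ℕ}
    (a : Fin n → H) (b : Fin (n + 1) → H) :
    tensorInner (n + 1) (PiTensorProduct.tprod ℂ (Fin.snoc (α := fun _ => H) a y))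
        (symmetrizer 0 q J (n + 1) (PiTensorProduct.tprod ℂ b)) =
      tensorInner n (PiTensorProduct.tprod ℂ a)
        (symmetrizer 0 q J n (annihilateSucc 0 q J y n (PiTensorProduct.tprod ℂ b))) := by
  rw [annihilateSucc_tprod, symmetrizer_zero_left_tprod]
  simp only [Complex.ofReal_zero, zero_smul, ite_self, add_zero, map_sum, map_smul,
    symmetrizer_zero_left_tprod, smul_eq_mul]
  rw [← (extendPerm_bijective n).sum_comp fun σ => (q : ℂ) ^ inversions σ *
      tensorInner (n + 1) (PiTensorProduct.tprod ℂ (Fin.snoc (α := fun _ => H) a y))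
        (PiTensorProduct.tprod ℂ (b ∘ σ)), Fintype.sum_prod_type]
  refine Finset.sum_congr rfl fun k _ => ?_
  rw [Finset.mul_sum, Finset.mul_sum]
  refine Finset.sum_congr rfl fun τ _ => ?_
  rw [comp_extendPerm, tensorInner_snoc, inversions_extendPerm, pow_add]
  simp only [Function.comp_def]
  ring

theorem sum_zero_pow_smul {n : ℕ} {M : Type*} [AddCommGroup M] [Module ℂ M]
    (f : Fin (n + 1) → M) :
    ∑ k : Fin (n + 1), (((0 : ℝ) : ℂ) ^ (n - k.val)) • f k = f (Fin.last n) := by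
  rw [Finset.sum_eq_single (Fin.last n)]
  · simp
  · intro k _ hk
    have : k.val < n := Fin.val_lt_last hk
    rw [Complex.ofReal_zero, zero_pow (by omega), zero_smul]
  · simp

theorem firstInvolution_tprod (J : H →ₗ[ℂ] H) {n : ℕ} (x : Fin n → H) :
    firstInvolution J n (PiTensorProduct.tprod ℂ x) =
      PiTensorProduct.tprod ℂ fun i => if i.val = 0 then J (x i) else x i := by
  rw [firstInvolution, PiTensorProduct.map_tprod]
  congr 1
  funext j
  split_ifs <;> rfl

/-- At q = 0 only the contraction of the last factor is left. If there are at least two factors, π₀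
acts on another one and passes through; if there is just one, π₀ acts on the contracted factor
itself, which produces the α-term. -/
theorem tensorInner_snoc_symmetrizer_zero_right (α : ℝ) {J : H →ₗ[ℂ] H} (hJ : J.IsSymmetric)
    (y : H) {n : ℕ} (a : Fin n → H) (b : Fin (n + 1) → H) :
    tensorInner (n + 1) (PiTensorProduct.tprod ℂ (Fin.snoc (α := fun _ => H) a y))
        (symmetrizer α 0 J (n + 1) (PiTensorProduct.tprod ℂ b)) =
      tensorInner n (PiTensorProduct.tprod ℂ a)
        (symmetrizer α 0 J n (annihilateSucc α 0 J y n (PiTensorProduct.tprod ℂ b))) := by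
  rw [annihilateSucc_tprod, sum_zero_pow_smul, symmetrizer_zero_right_succ]
  simp only [Fin.succAbove_last]
  rcases n with _ | n
  · rw [if_pos rfl, symmetrizer_deg_zero]
    simp only [LinearMap.add_apply, LinearMap.smul_apply, LinearMap.id_apply,
      firstInvolution_tprod, map_add, map_smul, tensorInner_tprod, Fin.prod_univ_castSucc,
      smul_eq_mul]
    have : Fin.snoc (α := fun _ => H) a y 0 = y := Fin.snoc_last (α := fun _ => H) y a
    simp [this, hJ y]
  · rw [if_neg (by omega), symmetrizer_zero_right_succ]
    simp only [LinearMap.add_apply, LinearMap.smul_apply, LinearMap.id_apply,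
      firstInvolution_tprod, map_add, map_smul, tensorInner_tprod,
      Fin.prod_univ_castSucc (n := n + 1), smul_eq_mul, add_zero, Fin.snoc_castSucc, Fin.snoc_last,
      Fin.val_castSucc, Fin.val_last, Nat.add_eq_zero_iff, one_ne_zero, and_false, if_false]
    ring

/-! ### The deformed form -/

theorem fockForm_lof_right (α q : ℝ) (J : H →ₗ[ℂ] H) (f : Fock H) {n : ℕ} (η : ⨂[ℂ]^n H) :
    fockForm α q J f (DirectSum.lof ℂ ℕ (fun n => ⨂[ℂ]^n H) n η) =
      tensorInner n (f n) (symmetrizer α q J n η) := by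
  rw [fockForm, DirectSum.toModule_lof]
  rfl

theorem fockForm_add_right (α q : ℝ) (J : H →ₗ[ℂ] H) (f g g' : Fock H) :
    fockForm α q J f (g + g') = fockForm α q J f g + fockForm α q J f g' := map_add _ _ _

theorem fockForm_smul_right (α q : ℝ) (J : H →ₗ[ℂ] H) (c : ℂ) (f g : Fock H) :
    fockForm α q J f (c • g) = c * fockForm α q J f g := map_smul _ _ _

theorem fockForm_zero_right (α q : ℝ) (J : H →ₗ[ℂ] H) (f : Fock H) :
    fockForm α q J f 0 = 0 := map_zero _

/-- Only linearity on the right is built into `fockForm`; additivity and antilinearity on the left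
are deduced from this symmetry. -/
theorem fockForm_conj_symm (α q : ℝ) {J : H →ₗ[ℂ] H} (hJ : J.IsSymmetric) (f g : Fock H) :
    starRingEnd ℂ (fockForm α q J f g) = fockForm α q J g f := by
  have hlof : ∀ (n : ℕ) (ξ : ⨂[ℂ]^n H) (g : Fock H),
      fockForm α q J (DirectSum.lof ℂ ℕ (fun n => ⨂[ℂ]^n H) n ξ) g =
        tensorInner n ξ (symmetrizer α q J n (g n)) := by
    intro n ξ g
    induction g using DirectSum.induction_on with
    | zero => rw [fockForm_zero_right, DirectSum.zero_apply, map_zero, map_zero]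
    | of m η =>
      rw [← DirectSum.lof_eq_of ℂ, fockForm_lof_right]
      by_cases h : m = n
      · subst h
        rw [DirectSum.lof_apply, DirectSum.lof_apply]
      · rw [DirectSum.lof_eq_of, DirectSum.lof_eq_of, DirectSum.of_eq_of_ne _ _ _ (by simpa using h),
          DirectSum.of_eq_of_ne _ _ _ (Ne.symm h)]
        simp
    | add a b ha hb => rw [fockForm_add_right, ha, hb, DirectSum.add_apply, map_add, map_add]
  induction g using DirectSum.induction_on with
  | zero =>
    rw [fockForm_zero_right, map_zero]
    induction f using DirectSum.induction_on with
    | zero => rw [fockForm_zero_right]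
    | of m η => rw [← DirectSum.lof_eq_of ℂ, fockForm_lof_right]; simp
    | add a b ha hb => rw [fockForm_add_right, ← ha, ← hb, add_zero]
  | of n η =>
    rw [← DirectSum.lof_eq_of ℂ, fockForm_lof_right, hlof, tensorInner_conj_symm,
      tensorInner_symmetrizer hJ]
  | add a b ha hb =>
    rw [fockForm_add_right, map_add, ha, hb]
    clear ha hb
    induction f using DirectSum.induction_on with
    | zero => simp [fockForm_zero_right]
    | of m η =>
      rw [← DirectSum.lof_eq_of ℂ, fockForm_lof_right, fockForm_lof_right, fockForm_lof_right,
        DirectSum.add_apply, map_add, LinearMap.add_apply]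
    | add f f' hf hf' =>
      rw [fockForm_add_right, fockForm_add_right, fockForm_add_right, ← hf, ← hf']
      ring

theorem fockForm_add_left (α q : ℝ) {J : H →ₗ[ℂ] H} (hJ : J.IsSymmetric) (f f' g : Fock H) :
    fockForm α q J (f + f') g = fockForm α q J f g + fockForm α q J f' g := by
  rw [← fockForm_conj_symm α q hJ, fockForm_add_right, map_add, fockForm_conj_symm α q hJ,
    fockForm_conj_symm α q hJ]

theorem fockForm_smul_left (α q : ℝ) {J : H →ₗ[ℂ] H} (hJ : J.IsSymmetric) (c : ℂ)
    (f g : Fock H) :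
    fockForm α q J (c • f) g = starRingEnd ℂ c * fockForm α q J f g := by
  rw [← fockForm_conj_symm α q hJ, fockForm_smul_right, map_mul, fockForm_conj_symm α q hJ]

theorem creation_lof_tprod (y : H) {n : ℕ} (a : Fin n → H) :
    creation y (DirectSum.lof ℂ ℕ (fun n => ⨂[ℂ]^n H) n (PiTensorProduct.tprod ℂ a)) =
      DirectSum.lof ℂ ℕ (fun n => ⨂[ℂ]^n H) (n + 1)
        (PiTensorProduct.tprod ℂ (Fin.snoc (α := fun _ => H) a y)) := by
  rw [creation, LinearMap.mulRight_apply, DirectSum.lof_eq_of, DirectSum.lof_eq_of,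
    DirectSum.of_mul_of, DirectSum.lof_eq_of]
  congr 1
  rw [TensorPower.tprod_mul_tprod, Fin.append_right_eq_snoc]

theorem fock_induction {p : Fock H → Prop} (f : Fock H)
    (tprod : ∀ (n : ℕ) (a : Fin n → H),
      p (DirectSum.lof ℂ ℕ (fun n => ⨂[ℂ]^n H) n (PiTensorProduct.tprod ℂ a)))
    (add : ∀ f g, p f → p g → p (f + g)) (smul : ∀ (c : ℂ) f, p f → p (c • f)) : p f := by
  have h0 : p 0 := by
    simpa using smul 0 _ (tprod 0 Fin.elim0)
  induction f using DirectSum.induction_on with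
  | zero => exact h0
  | of n ξ =>
    rw [← DirectSum.lof_eq_of ℂ]
    induction ξ using PiTensorProduct.induction_on with
    | smul_tprod r x =>
      rw [map_smul]
      exact smul _ _ (tprod n x)
    | add a b ha hb =>
      rw [map_add]
      exact add _ _ ha hb
  | add a b ha hb => exact add _ _ ha hb

theorem isFockAdjoint_annihilate {α q : ℝ} (h : α = 0 ∨ q = 0) {J : H →ₗ[ℂ] H}
    (hJ : J.IsSymmetric) (y : H) : IsFockAdjoint α q J (creation y) (annihilate α q J y) := by
  intro f g
  induction f using fock_induction with
  | add f f' hf hf' => rw [map_add, fockForm_add_left α q hJ, hf, hf', fockForm_add_left α q hJ]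
  | smul c f hf => rw [map_smul, fockForm_smul_left α q hJ, hf, fockForm_smul_left α q hJ]
  | tprod n a =>
    induction g using fock_induction with
    | add g g' hg hg' => rw [map_add, fockForm_add_right, hg, hg', fockForm_add_right]
    | smul c g hg => rw [map_smul, fockForm_smul_right, hg, fockForm_smul_right]
    | tprod m b =>
      rw [creation_lof_tprod]
      rcases m with _ | m
      · rw [annihilate_lof_zero, fockForm_zero_right, fockForm_lof_right, DirectSum.lof_eq_of,
          DirectSum.of_eq_of_ne _ _ _ (by omega)]
        simp
      · rw [annihilate_lof_succ, fockForm_lof_right, fockForm_lof_right]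
        by_cases hmn : m = n
        · subst hmn
          rw [DirectSum.lof_apply, DirectSum.lof_apply]
          rcases h with rfl | rfl
          · exact tensorInner_snoc_symmetrizer_zero_left q J y a b
          · exact tensorInner_snoc_symmetrizer_zero_right α hJ y a b
        · rw [DirectSum.lof_eq_of, DirectSum.lof_eq_of, DirectSum.of_eq_of_ne _ _ _ (by omega),
            DirectSum.of_eq_of_ne _ _ _ (by omega)]
          simp

theorem isFockAdjoint_annihilation {α q : ℝ} (h : α = 0 ∨ q = 0) {J : H →ₗ[ℂ] H}
    (hJ : J.IsSymmetric) (y : H) : IsFockAdjoint α q J (creation y) (annihilation α q J y) := by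
  have hex : ∃ S, IsFockAdjoint α q J (creation y) S := ⟨_, isFockAdjoint_annihilate h hJ y⟩
  rw [annihilation, dif_pos hex]
  exact hex.choose_spec

/-! ### The radical of the form -/

/-- The vectors which are orthogonal to all vectors. -/
def radical (α q : ℝ) (J : H →ₗ[ℂ] H) : Submodule ℂ (Fock H) where
  carrier := {h | ∀ f, fockForm α q J f h = 0}
  add_mem' := fun ha hb f => by rw [fockForm_add_right, ha, hb, add_zero]
  zero_mem' := fun f => fockForm_zero_right α q J f
  smul_mem' := fun c g hg f => by rw [fockForm_smul_right, hg, mul_zero]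

theorem IsFockAdjoint.symm {α q : ℝ} {J : H →ₗ[ℂ] H} (hJ : J.IsSymmetric)
    {T S : Module.End ℂ (Fock H)} (h : IsFockAdjoint α q J T S) : IsFockAdjoint α q J S T := by
  intro f g
  rw [← fockForm_conj_symm α q hJ, ← h, fockForm_conj_symm α q hJ]

theorem IsFockAdjoint.apply_mem_radical {α q : ℝ} {J : H →ₗ[ℂ] H}
    {T S : Module.End ℂ (Fock H)} (h : IsFockAdjoint α q J T S) {g : Fock H}
    (hg : g ∈ radical α q J) : S g ∈ radical α q J :=
  fun f => by rw [← h, hg]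

/-- For a possibly degenerate form, this is the form that uniqueness of adjoints takes. -/
theorem IsFockAdjoint.sub_mem_radical {α q : ℝ} {J : H →ₗ[ℂ] H}
    {T S S' : Module.End ℂ (Fock H)} (h : IsFockAdjoint α q J T S)
    (h' : IsFockAdjoint α q J T S') (g : Fock H) : S g - S' g ∈ radical α q J := by
  intro f
  rw [sub_eq_add_neg, ← neg_one_smul ℂ (S' g), fockForm_add_right, fockForm_smul_right, ← h, ← h']
  ring

/-! ### Positivity -/

theorem exists_finiteDimensional_tensor {n : ℕ} (ξ : ⨂[ℂ]^n H) :
    ∃ (K : Submodule ℂ H) (ξ' : ⨂[ℂ]^n K), FiniteDimensional ℂ K ∧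
      PiTensorProduct.map (fun _ => K.subtype) ξ' = ξ := by
  induction ξ using PiTensorProduct.induction_on with
  | smul_tprod r x =>
    refine ⟨Submodule.span ℂ (Set.range x), r • PiTensorProduct.tprod ℂ fun i =>
      ⟨x i, Submodule.subset_span ⟨i, rfl⟩⟩, FiniteDimensional.span_of_finite ℂ
      (Set.finite_range x), ?_⟩
    rw [map_smul, PiTensorProduct.map_tprod]
    rfl
  | add a b ha hb =>
    obtain ⟨K, a', hK, rfl⟩ := ha
    obtain ⟨L, b', hL, rfl⟩ := hb
    refine ⟨K ⊔ L, PiTensorProduct.map (fun _ => Submodule.inclusion le_sup_left) a' +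
      PiTensorProduct.map (fun _ => Submodule.inclusion le_sup_right) b', inferInstance, ?_⟩
    rw [map_add, ← LinearMap.comp_apply, ← LinearMap.comp_apply, ← PiTensorProduct.map_comp,
      ← PiTensorProduct.map_comp]
    rfl

theorem tensorInner_map_subtype (K : Submodule ℂ H) {n : ℕ} (ξ η : ⨂[ℂ]^n K) :
    tensorInner n (PiTensorProduct.map (fun _ => K.subtype) ξ)
      (PiTensorProduct.map (fun _ => K.subtype) η) = tensorInner n ξ η := by
  let T : (⨂[ℂ]^n K) →ₗ[ℂ] (⨂[ℂ]^n H) := PiTensorProduct.map (fun _ => K.subtype)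
  suffices h : (LinearMap.lcomp ℂ ℂ T).comp ((tensorInner n).comp T) = tensorInner n from
    congrArg (fun B : (⨂[ℂ]^n K) →ₗ⋆[ℂ] (⨂[ℂ]^n K) →ₗ[ℂ] ℂ => B ξ η) h
  refine tensorInner_ext fun x y => ?_
  simp [T, LinearMap.lcomp_apply, PiTensorProduct.map_tprod, tensorInner_tprod]

/-- A tensor involves only finitely many vectors, so it lives over a finite-dimensional subspace.
The products of an orthonormal basis are orthonormal there, and the form is the sum of the squared
moduli of the coordinates. -/
theorem tensorInner_self_pos {n : ℕ} {ξ : ⨂[ℂ]^n H} (hξ : ξ ≠ 0) : 0 < tensorInner n ξ ξ := by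
  classical
  obtain ⟨K, ξ', hK, rfl⟩ := exists_finiteDimensional_tensor ξ
  rw [tensorInner_map_subtype]
  let b := stdOrthonormalBasis ℂ K
  let B := Basis.piTensorProduct fun _ : Fin n => b.toBasis
  have hB : ∀ p p', tensorInner n (B p) (B p') = if p = p' then 1 else 0 := by
    intro p p'
    rw [Basis.piTensorProduct_apply, Basis.piTensorProduct_apply, tensorInner_tprod]
    simp only [OrthonormalBasis.coe_toBasis, b.inner_eq_ite]
    by_cases h : p = p'
    · subst h
      simp
    · rw [if_neg h]
      obtain ⟨i, hi⟩ := Function.ne_iff.mp h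
      exact Finset.prod_eq_zero (Finset.mem_univ i) (if_neg hi)
  have hsum : tensorInner n ξ' ξ' = ∑ p, starRingEnd ℂ (B.repr ξ' p) * B.repr ξ' p := by
    conv_lhs => rw [← B.sum_repr ξ']
    simp only [map_sum, LinearMap.sum_apply, map_smulₛₗ, LinearMap.smul_apply, hB, smul_eq_mul,
      RingHom.id_apply]
    simp [mul_comm]
  have hne : B.repr ξ' ≠ 0 := by
    intro h
    apply hξ
    rw [B.repr.map_eq_zero_iff] at h
    rw [h, map_zero]
  obtain ⟨p, hp⟩ := Finsupp.ne_iff.mp hne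
  rw [hsum]
  refine Finset.sum_pos' (fun i _ => ?_) ⟨p, Finset.mem_univ p, ?_⟩
  · rw [← Complex.normSq_eq_conj_mul_self]
    exact_mod_cast Complex.normSq_nonneg _
  · rw [← Complex.normSq_eq_conj_mul_self]
    exact_mod_cast Complex.normSq_pos.mpr hp

theorem tensorInner_self_nonneg {n : ℕ} (ξ : ⨂[ℂ]^n H) : 0 ≤ tensorInner n ξ ξ := by
  rcases eq_or_ne ξ 0 with rfl | h
  · simp
  · exact (tensorInner_self_pos h).le

theorem firstInvolution_firstInvolution {J : H →ₗ[ℂ] H} (hJ : Function.Involutive J) {n : ℕ}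
    (ξ : ⨂[ℂ]^n H) : firstInvolution J n (firstInvolution J n ξ) = ξ := by
  suffices h : firstInvolution J n ∘ₗ firstInvolution J n = LinearMap.id from
    LinearMap.congr_fun h ξ
  ext x
  simp only [LinearMap.compMultilinearMap_apply, LinearMap.comp_apply, firstInvolution_tprod,
    LinearMap.id_apply]
  congr 1
  funext i
  split_ifs
  · exact hJ _
  · rfl

theorem tensorInner_firstInvolution {J : H →ₗ[ℂ] H} (hJ : J.IsSymmetric) {n : ℕ}
    (ξ η : ⨂[ℂ]^(n + 1) H) :
    tensorInner (n + 1) (firstInvolution J (n + 1) ξ) η =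
      tensorInner (n + 1) ξ (firstInvolution J (n + 1) η) := by
  rw [← action_gen_zero, tensorInner_action hJ]
  rw [show (⟨gen (0 : Fin (n + 1)), gen_zero_mem n⟩ : typeBGroup (n + 1))⁻¹ =
    ⟨gen 0, gen_zero_mem n⟩ from Subtype.ext (gen_inv 0)]

theorem symmetrizer_zero_right_pos {α : ℝ} (h1 : -1 < α) (h2 : α < 1) {J : H →ₗ[ℂ] H}
    (hJ : Function.Involutive J) (hJsym : J.IsSymmetric) {n : ℕ} {ξ : ⨂[ℂ]^(n + 1) H}
    (hξ : ξ ≠ 0) : 0 < tensorInner (n + 1) ξ (symmetrizer α 0 J (n + 1) ξ) := by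
  set π := firstInvolution J (n + 1) with hπ
  have hππ : tensorInner (n + 1) (π ξ) (π ξ) = tensorInner (n + 1) ξ ξ := by
    rw [tensorInner_firstInvolution hJsym, firstInvolution_firstInvolution hJ]
  have hπl : tensorInner (n + 1) (π ξ) ξ = tensorInner (n + 1) ξ (π ξ) :=
    tensorInner_firstInvolution hJsym _ _
  -- Spectral decomposition of 1 + απ₀: the vectors (ξ ± π ξ)/2 are the components of ξ with
  -- eigenvalues 1 ± α.
  have key : tensorInner (n + 1) ξ (symmetrizer α 0 J (n + 1) ξ) =
      (((1 + α) / 4 : ℝ) : ℂ) * tensorInner (n + 1) (ξ + π ξ) (ξ + π ξ) +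
      (((1 - α) / 4 : ℝ) : ℂ) * tensorInner (n + 1) (ξ - π ξ) (ξ - π ξ) := by
    rw [symmetrizer_zero_right_succ]
    simp only [map_add, map_sub, LinearMap.add_apply, LinearMap.sub_apply, LinearMap.smul_apply,
      LinearMap.id_apply, map_smul, ← hπ, hππ, hπl, smul_eq_mul]
    push_cast
    ring
  have ha : (0 : ℂ) < (((1 + α) / 4 : ℝ) : ℂ) := by
    exact_mod_cast (by linarith : (0 : ℝ) < (1 + α) / 4)
  have hb : (0 : ℂ) < (((1 - α) / 4 : ℝ) : ℂ) := by
    exact_mod_cast (by linarith : (0 : ℝ) < (1 - α) / 4)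
  rw [key]
  by_cases h : ξ + π ξ = 0
  · refine add_pos_of_nonneg_of_pos (mul_nonneg ha.le (tensorInner_self_nonneg _))
      (mul_pos hb (tensorInner_self_pos fun h' => hξ ?_))
    have h3 : (2 : ℂ) • ξ = (ξ + π ξ) + (ξ - π ξ) := by rw [two_smul]; abel
    rw [h, h', add_zero] at h3
    exact (smul_eq_zero.mp h3).resolve_left two_ne_zero
  · exact add_pos_of_pos_of_nonneg (mul_pos ha (tensorInner_self_pos h))
      (mul_nonneg hb.le (tensorInner_self_nonneg _))

/-- On this span π₀ is the identity, so the symmetrizer is multiplication by 1 + α. -/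
theorem symmetrizer_zero_right_pos_of_mem_span {α : ℝ} (h1 : -1 < α) {J : H →ₗ[ℂ] H} {n : ℕ}
    {ξ : ⨂[ℂ]^(n + 1) H}
    (hmem : ξ ∈ Submodule.span ℂ {η : ⨂[ℂ]^(n + 1) H | ∃ y : Fin (n + 1) → H,
      (∀ i, J (y i) = y i) ∧ PiTensorProduct.tprod ℂ y = η})
    (hξ : ξ ≠ 0) : 0 < tensorInner (n + 1) ξ (symmetrizer α 0 J (n + 1) ξ) := by
  have hfix : firstInvolution J (n + 1) ξ = ξ := by
    clear hξ
    induction hmem using Submodule.span_induction with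
    | mem η h =>
      obtain ⟨y, hy, rfl⟩ := h
      rw [firstInvolution_tprod]
      simp only [hy, ite_self]
    | zero => rw [map_zero]
    | add a b _ _ ha hb => rw [map_add, ha, hb]
    | smul c a _ ha => rw [map_smul, ha]
  rw [symmetrizer_zero_right_succ, LinearMap.add_apply, LinearMap.smul_apply, hfix, map_add,
    map_smul, LinearMap.id_apply, smul_eq_mul, ← one_add_mul]
  have ha : (0 : ℂ) < 1 + (α : ℂ) := by
    exact_mod_cast (by linarith : (0 : ℝ) < 1 + α)
  exact mul_pos ha (tensorInner_self_pos hξ)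

/-! ### Tensors indexed by finite sets -/

theorem annihilate_vacuum (α q : ℝ) (J : H →ₗ[ℂ] H) (y : H) :
    annihilate α q J y (vacuum H) = 0 :=
  annihilate_lof_zero α q J y _

theorem annihilate_creation_vacuum (α q : ℝ) (J : H →ₗ[ℂ] H) (x y : H) :
    annihilate α q J y (creation x (vacuum H)) =
      (inner ℂ y x + α * inner ℂ (J y) x) • vacuum H := by
  have hx : Fin.snoc (α := fun _ => H) Fin.elim0 x 0 = x := Fin.snoc_last (α := fun _ => H) x _
  have ht : ∀ a : Fin 0 → H, DirectSum.lof ℂ ℕ (fun n => ⨂[ℂ]^n H) 0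
      (PiTensorProduct.tprod ℂ a) = vacuum H := fun a => by
    rw [vacuum, Subsingleton.elim a Fin.elim0]
  rw [← ht Fin.elim0, creation_lof_tprod, annihilate_lof_succ, annihilateSucc_tprod, if_pos rfl,
    Fin.sum_univ_one, add_smul, mul_smul, map_add]
  simp only [map_smul, ht, Fin.last_zero, hx]
  simp only [Fin.val_zero, Nat.sub_self, pow_zero, one_smul]

/-- The q-commutation relation. It is confined to positive degree because on the vacuum the term
α⟨Jy, x⟩ is added. -/
theorem annihilate_creation_lof_tprod (α q : ℝ) (J : H →ₗ[ℂ] H) (x y : H) {n : ℕ}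
    (a : Fin (n + 1) → H) (h : α = 0 ∨ q = 0) :
    annihilate α q J y (creation x
        (DirectSum.lof ℂ ℕ (fun n => ⨂[ℂ]^n H) (n + 1) (PiTensorProduct.tprod ℂ a))) =
      (q : ℂ) • creation x (annihilate α q J y
        (DirectSum.lof ℂ ℕ (fun n => ⨂[ℂ]^n H) (n + 1) (PiTensorProduct.tprod ℂ a))) +
      inner ℂ y x •
        DirectSum.lof ℂ ℕ (fun n => ⨂[ℂ]^n H) (n + 1) (PiTensorProduct.tprod ℂ a) := by
  have hqα : (q : ℂ) * α = 0 := by rcases h with rfl | rfl <;> simp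
  have hsnoc : ∀ k : Fin (n + 1), (fun i : Fin (n + 1) =>
      Fin.snoc (α := fun _ => H) a x (k.castSucc.succAbove i)) =
      Fin.snoc (α := fun _ => H) (fun i => a (k.succAbove i)) x := by
    intro k
    funext i
    refine Fin.lastCases ?_ (fun i => ?_) i
    · rw [Fin.succAbove_of_le_castSucc _ _ (Fin.castSucc_le_castSucc_iff.mpr (Fin.le_last k)),
        Fin.succ_last, Fin.snoc_last, Fin.snoc_last]
    · rw [Fin.castSucc_succAbove_castSucc, Fin.snoc_castSucc, Fin.snoc_castSucc]
  rw [creation_lof_tprod, annihilate_lof_succ, annihilate_lof_succ, annihilateSucc_tprod,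
    annihilateSucc_tprod, if_neg (by omega), add_zero, Fin.sum_univ_castSucc]
  -- In degree one `annihilate` has an α-term, which occurs here only with the factor qα = 0.
  have hlast : (q : ℂ) • creation x (DirectSum.lof ℂ ℕ (fun n => ⨂[ℂ]^n H) n
      (if n = 0 then (α : ℂ) • inner ℂ (J y) (a (Fin.last n)) •
        PiTensorProduct.tprod ℂ (fun i => a ((Fin.last n).succAbove i)) else 0)) = 0 := by
    split_ifs
    · rw [map_smul, map_smul, smul_smul, hqα, zero_smul]
    · simp
  rw [map_add, map_add, map_add, smul_add, hlast, add_zero]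
  congr 1
  · simp only [map_sum, map_smul, Finset.smul_sum, creation_lof_tprod, hsnoc, Fin.snoc_castSucc,
      Fin.val_castSucc]
    refine Finset.sum_congr rfl fun k _ => ?_
    rw [show n + 1 - k.val = (n - k.val) + 1 by omega, pow_succ', mul_smul]
  · simp [Fin.succAbove_last]

/-- The vector `x_{i_r} ⊗ ⋯ ⊗ x_{i_1}` for a list `i_1, …, i_r`. -/
def listTensor (x : ℕ → H) (L : List ℕ) : Fock H :=
  L.foldr (fun i f => creation (x i) f) (vacuum H)

theorem exists_listTensor_eq (x : ℕ → H) (L : List ℕ) :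
    ∃ a : Fin L.length → H, listTensor x L =
      DirectSum.lof ℂ ℕ (fun n => ⨂[ℂ]^n H) L.length (PiTensorProduct.tprod ℂ a) := by
  induction L with
  | nil => exact ⟨Fin.elim0, rfl⟩
  | cons i L ih =>
    obtain ⟨a, ha⟩ := ih
    refine ⟨Fin.snoc (α := fun _ => H) a (x i), (congrArg (creation (x i)) ha).trans ?_⟩
    exact creation_lof_tprod _ _

/-- The tensor product of the vectors `x_i`, `i ∈ s`, with decreasing indices. -/
def setTensor (x : ℕ → H) (s : Finset ℕ) : Fock H :=
  listTensor x (s.sort (· ≤ ·))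

theorem setTensor_empty (x : ℕ → H) : setTensor x ∅ = vacuum H := by
  rw [setTensor, Finset.sort_empty]
  rfl

theorem setTensor_insert (x : ℕ → H) {j : ℕ} {s : Finset ℕ} (h : ∀ i ∈ s, j < i) :
    setTensor x (insert j s) = creation (x j) (setTensor x s) := by
  rw [setTensor, Finset.sort_insert _ (fun i hi => (h i hi).le) fun hj => lt_irrefl _ (h j hj)]
  rfl

theorem fockForm_vacuum_setTensor (α q : ℝ) (J : H →ₗ[ℂ] H) (x : ℕ → H) (s : Finset ℕ) :
    fockForm α q J (vacuum H) (setTensor x s) = if s = ∅ then 1 else 0 := by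
  split_ifs with h
  · subst h
    rw [setTensor_empty, vacuum, fockForm_lof_right, symmetrizer_deg_zero, DirectSum.lof_apply]
    simp [tensorInner_tprod]
  · obtain ⟨a, ha⟩ := exists_listTensor_eq x (s.sort (· ≤ ·))
    rw [setTensor, ha, fockForm_lof_right, vacuum, DirectSum.lof_eq_of,
      DirectSum.of_eq_of_ne _ _ _ (by simpa using h)]
    simp

theorem annihilate_creation_setTensor {α q : ℝ} (h : α = 0 ∨ q = 0) (J : H →ₗ[ℂ] H) (y z : H)
    (x : ℕ → H) {s : Finset ℕ} (hs : s.Nonempty) :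
    annihilate α q J y (creation z (setTensor x s)) =
      (q : ℂ) • creation z (annihilate α q J y (setTensor x s)) +
        inner ℂ y z • setTensor x s := by
  obtain ⟨a, ha⟩ := exists_listTensor_eq x (s.sort (· ≤ ·))
  rw [setTensor, ha]
  have hlen : (s.sort (· ≤ ·)).length ≠ 0 := by
    rw [Finset.length_sort]
    exact hs.card_ne_zero
  revert a
  generalize (s.sort (· ≤ ·)).length = n at hlen
  obtain ⟨n, rfl⟩ := Nat.exists_eq_succ_of_ne_zero hlen
  intro a _
  exact annihilate_creation_lof_tprod α q J z y a h

/-- Indices decrease from left to right, so the factors to the right of x k are those with index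
below k, each contributing q. As J y = y, the extra term in degree one replaces the coefficient 1 by
1 + α, which happens only for s = {k}. -/
theorem annihilate_setTensor {α q : ℝ} (h : α = 0 ∨ q = 0) (J : H →ₗ[ℂ] H) {y : H}
    (hy : J y = y) (x : ℕ → H) (s : Finset ℕ) :
    annihilate α q J y (setTensor x s) =
      ∑ k ∈ s, ((q : ℂ) ^ (s.filter (· < k)).card * (1 + if s = {k} then (α : ℂ) else 0) *
        inner ℂ y (x k)) • setTensor x (s.erase k) := by
  have hqα : (q : ℂ) * α = 0 := by rcases h with rfl | rfl <;> simp
  induction s using Finset.induction_on_min with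
  | empty => rw [setTensor_empty, annihilate_vacuum, Finset.sum_empty]
  | insert j s hj ih =>
    have hjs : j ∉ s := fun h => lt_irrefl _ (hj j h)
    rw [setTensor_insert x hj, Finset.sum_insert hjs, Finset.erase_insert hjs]
    have hf : (insert j s).filter (· < j) = ∅ := by
      rw [Finset.filter_eq_empty_iff]
      intro i hi
      rcases Finset.mem_insert.mp hi with rfl | hi
      · exact lt_irrefl _
      · exact (hj i hi).not_gt
    rw [hf, Finset.card_empty, pow_zero, one_mul]
    rcases s.eq_empty_or_nonempty with rfl | hs
    · rw [setTensor_empty, annihilate_creation_vacuum, hy]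
      simp only [Finset.sum_empty, add_zero, insert_empty_eq, if_true]
      congr 1
      ring
    · rw [annihilate_creation_setTensor h J y (x j) x hs, ih, if_neg, add_zero, one_mul, add_comm]
      · congr 1
        rw [map_sum, Finset.smul_sum]
        refine Finset.sum_congr rfl fun k hk => ?_
        have hjk := hj k hk
        have h1 : (insert j s).filter (· < k) = insert j (s.filter (· < k)) := by
          rw [Finset.filter_insert, if_pos hjk]
        have h2 : insert j s ≠ {k} := fun h' => by
          have := h' ▸ Finset.mem_insert_self j s
          exact hjk.ne (Finset.mem_singleton.mp this)
        have h3 : setTensor x ((insert j s).erase k) = creation (x j) (setTensor x (s.erase k)) := by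
          rw [Finset.erase_insert_of_ne hjk.ne, setTensor_insert]
          exact fun i hi => hj i (Finset.mem_of_mem_erase hi)
        rw [h1, Finset.card_insert_of_notMem (by simp [hjs]), if_neg h2, h3, map_smul, smul_smul,
          add_zero, mul_one, pow_succ']
        congr 1
        -- For s = {k} the inductive coefficient contains α, although the larger set is not a
        -- singleton; the new factor q removes it.
        split_ifs
        · linear_combination (q : ℂ) ^ (s.filter (· < k)).card * inner ℂ y (x k) * hqα
        · ring
      · intro h'
        obtain ⟨i, hi⟩ := hs
        have := h' ▸ Finset.mem_insert_of_mem (b := j) hi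
        exact (hj i hi).ne' (Finset.mem_singleton.mp this)

/-! ### Matchings of finite sets of natural numbers -/

/-- `M` is a partition of `s` into pairs `(i, j)` with `i < j`. -/
structure IsMatching (M : Finset (ℕ × ℕ)) (s : Finset ℕ) : Prop where
  lt : ∀ p ∈ M, p.1 < p.2
  fst_mem : ∀ p ∈ M, p.1 ∈ s
  snd_mem : ∀ p ∈ M, p.2 ∈ s
  exists_mem : ∀ i ∈ s, ∃ p ∈ M, i = p.1 ∨ i = p.2
  eq_of_mem : ∀ p ∈ M, ∀ p' ∈ M, ∀ i, (i = p.1 ∨ i = p.2) → (i = p'.1 ∨ i = p'.2) → p = p'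

open Classical in
/-- The matchings of `{0, …, j - 1} ∪ s` all of whose pairs have an element less than `j`. -/
def openMatchings (j : ℕ) (s : Finset ℕ) : Finset (Finset (ℕ × ℕ)) :=
  Finset.filter (fun M : Finset (ℕ × ℕ) => IsMatching M (Finset.range j ∪ s) ∧ ∀ p ∈ M, p.1 < j)
    ((Finset.range j ∪ s) ×ˢ (Finset.range j ∪ s)).powerset

theorem mem_openMatchings {j : ℕ} {s : Finset ℕ} {M : Finset (ℕ × ℕ)} :
    M ∈ openMatchings j s ↔ IsMatching M (Finset.range j ∪ s) ∧ ∀ p ∈ M, p.1 < j := by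
  classical
  rw [openMatchings, Finset.mem_filter, Finset.mem_powerset, and_iff_right_iff_imp]
  exact fun h p hp => Finset.mem_product.mpr ⟨h.1.fst_mem p hp, h.1.snd_mem p hp⟩

/-- The pairs of crossing elements of `M`. -/
def matchingCrossings (M : Finset (ℕ × ℕ)) : ℕ :=
  ((M ×ˢ M).filter fun P => P.1.1 < P.2.1 ∧ P.2.1 < P.1.2 ∧ P.1.2 < P.2.2).card

/-- The number of elements of `M` below another element. -/
def matchingInner (M : Finset (ℕ × ℕ)) : ℕ :=
  (M.filter fun p => ∃ p' ∈ M, p'.1 < p.1 ∧ p.2 < p'.2).card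

theorem openMatchings_zero (s : Finset ℕ) :
    openMatchings 0 s = if s = ∅ then {∅} else ∅ := by
  split_ifs with h
  · subst h
    ext M
    rw [mem_openMatchings, Finset.mem_singleton]
    constructor
    · rintro ⟨-, h⟩
      exact Finset.eq_empty_of_forall_notMem fun p hp => Nat.not_lt_zero _ (h p hp)
    · rintro rfl
      exact ⟨⟨by simp, by simp, by simp, by simp, by simp⟩, by simp⟩
  · refine Finset.eq_empty_of_forall_notMem fun M hM => ?_
    rw [mem_openMatchings] at hM
    obtain ⟨i, hi⟩ := Finset.nonempty_iff_ne_empty.mpr h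
    obtain ⟨p, hp, -⟩ := hM.1.exists_mem i (Finset.mem_union_right _ hi)
    exact Nat.not_lt_zero _ (hM.2 p hp)

/-- A point j at which no pair begins is a right end, hence joins the open points waiting for a
partner below j. -/
theorem mem_openMatchings_succ_of_forall_ne {j : ℕ} {s : Finset ℕ} {M : Finset (ℕ × ℕ)} :
    (M ∈ openMatchings (j + 1) s ∧ ∀ p ∈ M, p.1 ≠ j) ↔ M ∈ openMatchings j (insert j s) := by
  have h : Finset.range (j + 1) ∪ s = Finset.range j ∪ insert j s := by
    rw [Finset.range_add_one, Finset.insert_union, Finset.union_insert]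
  rw [mem_openMatchings, mem_openMatchings, h]
  constructor
  · rintro ⟨⟨h1, h2⟩, h3⟩
    exact ⟨h1, fun p hp => by have := h2 p hp; have := h3 p hp; omega⟩
  · rintro ⟨h1, h2⟩
    exact ⟨⟨h1, fun p hp => (h2 p hp).trans (Nat.lt_succ_self j)⟩, fun p hp => (h2 p hp).ne⟩

theorem notMem_of_mem_openMatchings_erase {j k : ℕ} {s : Finset ℕ} {M : Finset (ℕ × ℕ)}
    (hM : M ∈ openMatchings j (s.erase k)) : (j, k) ∉ M := fun h =>
  lt_irrefl j ((mem_openMatchings.mp hM).2 _ h)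

/-! ### The step at the point j: opening it or joining it to an open point -/

section Step

variable {j k : ℕ} {s : Finset ℕ} (hs : ∀ i ∈ s, j < i)
include hs

theorem insert_mem_openMatchings (hk : k ∈ s) {M : Finset (ℕ × ℕ)}
    (hM : M ∈ openMatchings j (s.erase k)) : insert (j, k) M ∈ openMatchings (j + 1) s := by
  rw [mem_openMatchings] at hM ⊢
  obtain ⟨hM, hlt⟩ := hM
  have hjk := hs k hk
  have hjs : j ∉ s := fun h => lt_irrefl _ (hs j h)
  have hf := hM.fst_mem
  have hsn := hM.snd_mem
  simp only [Finset.mem_union, Finset.mem_range, Finset.mem_erase] at hf hsn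
  refine ⟨⟨?_, ?_, ?_, ?_, ?_⟩, ?_⟩
  · intro p hp
    rcases Finset.mem_insert.mp hp with rfl | hp
    · exact hjk
    · exact hM.lt p hp
  · intro p hp
    rw [Finset.mem_union, Finset.mem_range]
    rcases Finset.mem_insert.mp hp with rfl | hp
    · exact Or.inl (Nat.lt_succ_self j)
    · exact Or.inl ((hlt p hp).trans (Nat.lt_succ_self j))
  · intro p hp
    rw [Finset.mem_union, Finset.mem_range]
    rcases Finset.mem_insert.mp hp with rfl | hp
    · exact Or.inr hk
    · exact (hsn p hp).imp (fun h => h.trans (Nat.lt_succ_self j)) And.right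
  · intro i hi
    by_cases hik : i = j ∨ i = k
    · exact ⟨_, Finset.mem_insert_self _ _, hik⟩
    · push Not at hik
      obtain ⟨p, hp, hip⟩ := hM.exists_mem i (by
        simp only [Finset.mem_union, Finset.mem_range, Finset.mem_erase] at hi ⊢
        rcases hi with h | h
        · exact Or.inl (by omega)
        · exact Or.inr ⟨hik.2, h⟩)
      exact ⟨p, Finset.mem_insert_of_mem hp, hip⟩
  · have hne : ∀ p ∈ M, ∀ i, (i = j ∨ i = k) → ¬ (i = p.1 ∨ i = p.2) := by
      intro p hp i hi hip
      have h1 := hlt p hp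
      have h2 := hsn p hp
      rcases hi with rfl | rfl <;> rcases hip with h | h
      · omega
      · rw [← h] at h2
        exact h2.elim (lt_irrefl _) fun h => hjs h.2
      · omega
      · rw [← h] at h2
        exact h2.elim (fun h => by omega) fun h => h.1 rfl
    intro p hp p' hp' i hi hi'
    rcases Finset.mem_insert.mp hp with rfl | hp <;> rcases Finset.mem_insert.mp hp' with rfl | hp'
    · rfl
    · exact absurd hi' (hne p' hp' i hi)
    · exact absurd hi (hne p hp i hi')
    · exact hM.eq_of_mem p hp p' hp' i hi hi'
  · intro p hp
    rcases Finset.mem_insert.mp hp with rfl | hp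
    · exact Nat.lt_succ_self j
    · exact (hlt p hp).trans (Nat.lt_succ_self j)

theorem erase_mem_openMatchings {M : Finset (ℕ × ℕ)} (hM : M ∈ openMatchings (j + 1) s)
    (hp : (j, k) ∈ M) : k ∈ s ∧ M.erase (j, k) ∈ openMatchings j (s.erase k) := by
  rw [mem_openMatchings] at hM ⊢
  obtain ⟨hM, hlt⟩ := hM
  have hjk : j < k := hM.lt _ hp
  have hk : k ∈ s := by
    have := hM.snd_mem _ hp
    rw [Finset.mem_union, Finset.mem_range] at this
    exact this.resolve_left (by simp; omega)
  have hlt' : ∀ p ∈ M.erase (j, k), p.1 < j := by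
    intro p h
    rw [Finset.mem_erase] at h
    have h1 := hlt p h.2
    have h2 : p.1 ≠ j := fun h' => h.1 (hM.eq_of_mem p h.2 _ hp j (Or.inl h'.symm) (Or.inl rfl))
    omega
  refine ⟨hk, ⟨fun p h => hM.lt p (Finset.mem_of_mem_erase h), fun p h =>
    Finset.mem_union_left _ (Finset.mem_range.mpr (hlt' p h)), ?_, ?_,
    fun p h p' h' => hM.eq_of_mem p (Finset.mem_of_mem_erase h) p' (Finset.mem_of_mem_erase h')⟩,
    hlt'⟩
  · intro p h
    rw [Finset.mem_erase] at h
    have h1 := hM.snd_mem p h.2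
    have h2 : p.2 ≠ j := fun h' => h.1 (hM.eq_of_mem p h.2 _ hp j (Or.inr h'.symm) (Or.inl rfl))
    have h3 : p.2 ≠ k := fun h' => h.1 (hM.eq_of_mem p h.2 _ hp k (Or.inr h'.symm) (Or.inr rfl))
    simp only [Finset.mem_union, Finset.mem_range, Finset.mem_erase] at h1 ⊢
    rcases h1 with h1 | h1
    · exact Or.inl (by omega)
    · exact Or.inr ⟨h3, h1⟩
  · intro i hi
    simp only [Finset.mem_union, Finset.mem_range, Finset.mem_erase] at hi
    have hik : i ≠ j ∧ i ≠ k := by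
      rcases hi with h | h
      · omega
      · exact ⟨(hs i h.2).ne', h.1⟩
    obtain ⟨p, h, hip⟩ := hM.exists_mem i (by
      rw [Finset.mem_union, Finset.mem_range]
      exact hi.imp (fun h => h.trans (Nat.lt_succ_self j)) And.right)
    refine ⟨p, Finset.mem_erase.mpr ⟨?_, h⟩, hip⟩
    rintro rfl
    exact hip.elim hik.1 hik.2

/-- Either j is a right end and stays open, or it is the left end of a pair (j, k), where k must be
one of the open points; deleting this pair is invertible. -/
theorem sum_openMatchings_succ {A : Type*} [AddCommMonoid A] (F : Finset (ℕ × ℕ) → A) :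
    ∑ M ∈ openMatchings (j + 1) s, F M =
      ∑ M ∈ openMatchings j (insert j s), F M +
        ∑ k ∈ s, ∑ M ∈ openMatchings j (s.erase k), F (insert (j, k) M) := by
  classical
  rw [← Finset.sum_filter_add_sum_filter_not _ (fun M => ∀ p ∈ M, p.1 ≠ j)]
  congr 1
  · refine Finset.sum_congr ?_ fun _ _ => rfl
    ext M
    rw [Finset.mem_filter, mem_openMatchings_succ_of_forall_ne]
  · have h : (openMatchings (j + 1) s).filter (fun M => ¬ ∀ p ∈ M, p.1 ≠ j) =
        s.biUnion fun k => (openMatchings j (s.erase k)).image (insert (j, k)) := by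
      ext M
      simp only [Finset.mem_filter, Finset.mem_biUnion, Finset.mem_image]
      constructor
      · rintro ⟨hM, h⟩
        push Not at h
        obtain ⟨⟨j', k⟩, hp, rfl⟩ := h
        obtain ⟨hk, hM'⟩ := erase_mem_openMatchings hs hM hp
        exact ⟨k, hk, _, hM', Finset.insert_erase hp⟩
      · rintro ⟨k, hk, M, hM, rfl⟩
        refine ⟨insert_mem_openMatchings hs hk hM, fun h => ?_⟩
        exact h _ (Finset.mem_insert_self _ _) rfl
    rw [h, Finset.sum_biUnion]
    · refine Finset.sum_congr rfl fun k _ => Finset.sum_image ?_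
      intro M hM M' hM' h
      rw [← Finset.erase_insert (notMem_of_mem_openMatchings_erase hM), h,
        Finset.erase_insert (notMem_of_mem_openMatchings_erase hM')]
    · intro k hk k' hk' hne
      rw [Function.onFun, Finset.disjoint_left]
      intro M hM hM'
      rw [Finset.mem_image] at hM hM'
      obtain ⟨M₁, hM₁, rfl⟩ := hM
      obtain ⟨M₂, -, h₂⟩ := hM'
      have h3 := (mem_openMatchings.mp (insert_mem_openMatchings hs hk hM₁)).1.eq_of_mem (j, k)
        (Finset.mem_insert_self _ _) (j, k') (h₂ ▸ Finset.mem_insert_self _ _) j (Or.inl rfl)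
        (Or.inl rfl)
      exact hne (congrArg Prod.snd h3)

theorem snd_lt_or_mem {M : Finset (ℕ × ℕ)} (hM : M ∈ openMatchings j (s.erase k)) {i : ℕ}
    (hi : i ∈ s.erase k) : ∃ p ∈ M, p.2 = i ∧ p.1 < j := by
  obtain ⟨hM, hlt⟩ := mem_openMatchings.mp hM
  obtain ⟨p, hp, h⟩ := hM.exists_mem i (Finset.mem_union_right _ hi)
  have h1 := hlt p hp
  have h2 := hs i (Finset.mem_of_mem_erase hi)
  exact ⟨p, hp, by omega, h1⟩

/-- All pairs of M begin below j, so (j, k) crosses exactly those ending strictly between j and k.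
Their right ends are the elements of s below k. -/
theorem matchingCrossings_insert (hk : k ∈ s) {M : Finset (ℕ × ℕ)}
    (hM : M ∈ openMatchings j (s.erase k)) :
    matchingCrossings (insert (j, k) M) = (s.filter (· < k)).card + matchingCrossings M := by
  have hjk := hs k hk
  have hlt := (mem_openMatchings.mp hM).2
  have hnot := notMem_of_mem_openMatchings_erase hM
  have h : ((insert (j, k) M) ×ˢ (insert (j, k) M)).filter
      (fun P => P.1.1 < P.2.1 ∧ P.2.1 < P.1.2 ∧ P.1.2 < P.2.2) =
      (M.filter fun p => j < p.2 ∧ p.2 < k).image (fun p => (p, (j, k))) ∪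
      (M ×ˢ M).filter (fun P => P.1.1 < P.2.1 ∧ P.2.1 < P.1.2 ∧ P.1.2 < P.2.2) := by
    ext ⟨p, p'⟩
    simp only [Finset.mem_filter, Finset.mem_product, Finset.mem_union, Finset.mem_image,
      Finset.mem_insert, Prod.mk.injEq]
    constructor
    · rintro ⟨⟨rfl | hp, rfl | hp'⟩, h1, h2, h3⟩
      · exact absurd h1 (lt_irrefl _)
      · exact absurd h1 (hlt p' hp').not_gt
      · exact Or.inl ⟨p, ⟨hp, h2, h3⟩, rfl, rfl⟩
      · exact Or.inr ⟨⟨hp, hp'⟩, h1, h2, h3⟩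
    · rintro (⟨p, ⟨hp, h2, h3⟩, rfl, rfl⟩ | ⟨⟨hp, hp'⟩, h⟩)
      · exact ⟨⟨Or.inr hp, Or.inl rfl⟩, hlt _ hp, h2, h3⟩
      · exact ⟨⟨Or.inr hp, Or.inr hp'⟩, h⟩
  rw [matchingCrossings, h, Finset.card_union_of_disjoint, Finset.card_image_of_injective,
    matchingCrossings]
  · congr 1
    refine Finset.card_bij (fun p _ => p.2) ?_ ?_ ?_
    · intro p hp
      rw [Finset.mem_filter] at hp ⊢
      have := (mem_openMatchings.mp hM).1.snd_mem p hp.1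
      rw [Finset.mem_union, Finset.mem_range] at this
      exact ⟨Finset.mem_of_mem_erase (this.resolve_left hp.2.1.not_gt), hp.2.2⟩
    · intro p hp p' hp' h
      exact (mem_openMatchings.mp hM).1.eq_of_mem p (Finset.mem_filter.mp hp).1 p'
        (Finset.mem_filter.mp hp').1 p.2 (Or.inr rfl) (Or.inr h)
    · intro i hi
      rw [Finset.mem_filter] at hi
      obtain ⟨p, hp, rfl, -⟩ := snd_lt_or_mem hs hM (Finset.mem_erase.mpr ⟨hi.2.ne, hi.1⟩)
      exact ⟨p, Finset.mem_filter.mpr ⟨hp, hs _ hi.1, hi.2⟩, rfl⟩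
  · exact fun p p' h => (Prod.mk.inj h).1
  · rw [Finset.disjoint_left]
    intro P hP hP'
    rw [Finset.mem_image] at hP
    obtain ⟨p, -, rfl⟩ := hP
    exact hnot (Finset.mem_product.mp (Finset.mem_filter.mp hP').1).2

/-- Since all pairs of M begin below j, the new pair covers none of them; it is itself covered
exactly if an open point of s lies beyond k. -/
theorem matchingInner_insert (hk : k ∈ s) {M : Finset (ℕ × ℕ)}
    (hM : M ∈ openMatchings j (s.erase k)) [Decidable (∃ i ∈ s, k < i)] :
    matchingInner (insert (j, k) M) = (if ∃ i ∈ s, k < i then 1 else 0) + matchingInner M := by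
  have hjk := hs k hk
  have hlt := (mem_openMatchings.mp hM).2
  have hnot := notMem_of_mem_openMatchings_erase hM
  have h1 : (∃ p' ∈ insert (j, k) M, p'.1 < j ∧ k < p'.2) ↔ ∃ i ∈ s, k < i := by
    constructor
    · rintro ⟨p, hp, h1, h2⟩
      rcases Finset.mem_insert.mp hp with rfl | hp
      · exact absurd h1 (lt_irrefl _)
      · have := (mem_openMatchings.mp hM).1.snd_mem p hp
        rw [Finset.mem_union, Finset.mem_range] at this
        exact ⟨p.2, Finset.mem_of_mem_erase (this.resolve_left (by omega)), h2⟩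
    · rintro ⟨i, hi, hki⟩
      obtain ⟨p, hp, rfl, h⟩ := snd_lt_or_mem hs hM (Finset.mem_erase.mpr ⟨hki.ne', hi⟩)
      exact ⟨p, Finset.mem_insert_of_mem hp, h, hki⟩
  have h2 : M.filter (fun p => ∃ p' ∈ insert (j, k) M, p'.1 < p.1 ∧ p.2 < p'.2) =
      M.filter fun p => ∃ p' ∈ M, p'.1 < p.1 ∧ p.2 < p'.2 := by
    refine Finset.filter_congr fun p hp => ?_
    constructor
    · rintro ⟨p', hp', h⟩
      rcases Finset.mem_insert.mp hp' with rfl | hp'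
      · exact absurd h.1 (hlt p hp).not_gt
      · exact ⟨p', hp', h⟩
    · rintro ⟨p', hp', h⟩
      exact ⟨p', Finset.mem_insert_of_mem hp', h⟩
  rw [matchingInner, matchingInner, Finset.filter_insert, h2]
  simp only [h1]
  split_ifs
  · rw [Finset.card_insert_of_notMem fun h => hnot (Finset.mem_filter.mp h).1, add_comm]
  · rw [zero_add]

end Step

-- T s plays the vector with open points s and φ the vacuum state. The operator of largest index
-- acts first, so the induction splits it off; the terms of `hg` match those of
-- `sum_openMatchings_succ`, and the coefficients record the new crossings and inner pairs.
open Classical in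
theorem sum_openMatchings_of_recursion {V : Type*} [AddCommGroup V] [Module ℂ V]
    (g : ℕ → Module.End ℂ V) (T : Finset ℕ → V) (φ : V →ₗ[ℂ] ℂ) (q t : ℂ) (w : ℕ → ℕ → ℂ)
    (hφ : ∀ s, φ (T s) = if s = ∅ then 1 else 0)
    (hg : ∀ j s, (∀ i ∈ s, j < i) → g j (T s) = T (insert j s) +
      ∑ k ∈ s, (q ^ (s.filter (· < k)).card * t ^ (if ∃ i ∈ s, k < i then 1 else 0) * w j k) •
        T (s.erase k))
    (n : ℕ) (s : Finset ℕ) (hs : ∀ i ∈ s, n ≤ i) :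
    φ (((List.range n).map g).prod (T s)) = ∑ M ∈ openMatchings n s,
      q ^ matchingCrossings M * t ^ matchingInner M * ∏ p ∈ M, w p.1 p.2 := by
  induction n generalizing s with
  | zero =>
    rw [openMatchings_zero, List.range_zero, List.map_nil, List.prod_nil, Module.End.one_apply, hφ]
    split_ifs
    · simp [matchingCrossings, matchingInner]
    · simp
  | succ n ih =>
    rw [List.range_succ, List.map_append, List.prod_append, List.map_singleton,
      List.prod_singleton, Module.End.mul_apply, hg n s hs, map_add, map_add, map_sum, map_sum,
      sum_openMatchings_succ hs, ih]
    · congr 1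
      refine Finset.sum_congr rfl fun k hk => ?_
      rw [map_smul, map_smul, ih, smul_eq_mul, Finset.mul_sum]
      · refine Finset.sum_congr rfl fun M hM => ?_
        rw [matchingCrossings_insert hs hk hM, matchingInner_insert hs hk hM,
          Finset.prod_insert (notMem_of_mem_openMatchings_erase hM), pow_add, pow_add]
        ring
      · exact fun i hi => Nat.le_of_lt (hs i (Finset.mem_of_mem_erase hi))
    · intro i hi
      rcases Finset.mem_insert.mp hi with rfl | hi
      · exact le_rfl
      · exact Nat.le_of_lt (hs i hi)

/-! ### Pair partitions and matchings -/

theorem pair_eq_pair_of_lt {α : Type*} [LinearOrder α] {a b c d : α} (hab : a < b) (hcd : c < d)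
    (h : ({a, b} : Finset α) = {c, d}) : a = c ∧ b = d := by
  have ha : a ∈ ({c, d} : Finset α) := h ▸ Finset.mem_insert_self a {b}
  have hb : b ∈ ({c, d} : Finset α) :=
    h ▸ Finset.mem_insert_of_mem (b := a) (Finset.mem_singleton_self b)
  rw [Finset.mem_insert, Finset.mem_singleton] at ha hb
  rcases ha with rfl | rfl <;> rcases hb with rfl | rfl
  · exact absurd hab (lt_irrefl _)
  · exact ⟨rfl, rfl⟩
  · exact absurd hcd hab.not_gt
  · exact absurd hab (lt_irrefl _)

/-- The pairs `(i, j)` with `i < j` for which `{i, j}` is a block. -/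
def blockPairs {n : ℕ} (π : Finpartition (Finset.univ : Finset (Fin n))) :
    Finset (Fin n × Fin n) :=
  Finset.univ.filter fun p => p.1 < p.2 ∧ {p.1, p.2} ∈ π.parts

theorem mem_blockPairs {n : ℕ} {π : Finpartition (Finset.univ : Finset (Fin n))}
    {p : Fin n × Fin n} : p ∈ blockPairs π ↔ p.1 < p.2 ∧ {p.1, p.2} ∈ π.parts := by
  simp [blockPairs]

theorem mem_pairPartitions {n : ℕ} {π : Finpartition (Finset.univ : Finset (Fin n))} :
    π ∈ pairPartitions n ↔ ∀ V ∈ π.parts, V.card = 2 := by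
  simp [pairPartitions]

theorem exists_blockPairs {n : ℕ} {π : Finpartition (Finset.univ : Finset (Fin n))}
    (hπ : π ∈ pairPartitions n) {V : Finset (Fin n)} (hV : V ∈ π.parts) :
    ∃ p ∈ blockPairs π, V = {p.1, p.2} := by
  obtain ⟨a, b, hab, rfl⟩ := Finset.card_eq_two.mp (mem_pairPartitions.mp hπ V hV)
  rcases lt_or_gt_of_ne hab with h | h
  · exact ⟨(a, b), mem_blockPairs.mpr ⟨h, hV⟩, rfl⟩
  · exact ⟨(b, a), mem_blockPairs.mpr ⟨h, Finset.pair_comm a b ▸ hV⟩, Finset.pair_comm a b⟩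

theorem eq_of_pair_eq {n : ℕ} {π : Finpartition (Finset.univ : Finset (Fin n))}
    {p p' : Fin n × Fin n} (hp : p ∈ blockPairs π) (hp' : p' ∈ blockPairs π)
    (h : ({p.1, p.2} : Finset (Fin n)) = {p'.1, p'.2}) : p = p' := by
  have := pair_eq_pair_of_lt (mem_blockPairs.mp hp).1 (mem_blockPairs.mp hp').1 h
  exact Prod.ext this.1 this.2

/-- The pairs of natural numbers which a partition of `Fin n` defines. -/
def toMatching {n : ℕ} (π : Finpartition (Finset.univ : Finset (Fin n))) : Finset (ℕ × ℕ) :=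
  (blockPairs π).map (Fin.valEmbedding.prodMap Fin.valEmbedding)

theorem mem_toMatching {n : ℕ} {π : Finpartition (Finset.univ : Finset (Fin n))} {p : ℕ × ℕ} :
    p ∈ toMatching π ↔ ∃ p' ∈ blockPairs π, (p'.1.val, p'.2.val) = p := by
  simp only [toMatching, Finset.mem_map]
  rfl

theorem toMatching_mem {n : ℕ} {π : Finpartition (Finset.univ : Finset (Fin n))}
    (hπ : π ∈ pairPartitions n) : toMatching π ∈ openMatchings n ∅ := by
  rw [mem_openMatchings, Finset.union_empty]
  refine ⟨⟨?_, ?_, ?_, ?_, ?_⟩, ?_⟩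
  · intro p hp
    obtain ⟨p, hb, rfl⟩ := mem_toMatching.mp hp
    exact (mem_blockPairs.mp hb).1
  · intro p hp
    obtain ⟨p, hp, rfl⟩ := mem_toMatching.mp hp
    exact Finset.mem_range.mpr p.1.2
  · intro p hp
    obtain ⟨p, hp, rfl⟩ := mem_toMatching.mp hp
    exact Finset.mem_range.mpr p.2.2
  · intro i hi
    obtain ⟨V, hV, hiV⟩ := π.exists_mem (Finset.mem_univ (⟨i, Finset.mem_range.mp hi⟩ : Fin n))
    obtain ⟨p, hp, rfl⟩ := exists_blockPairs hπ hV
    refine ⟨_, mem_toMatching.mpr ⟨p, hp, rfl⟩, ?_⟩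
    simpa [Fin.ext_iff] using hiV
  · intro p hp p' hp' i hi hi'
    obtain ⟨p, hb, rfl⟩ := mem_toMatching.mp hp
    obtain ⟨p', hb', rfl⟩ := mem_toMatching.mp hp'
    have hlt : i < n := by rcases hi with rfl | rfl <;> exact Fin.is_lt _
    have h1 : (⟨i, hlt⟩ : Fin n) ∈ ({p.1, p.2} : Finset (Fin n)) := by
      simpa [Fin.ext_iff] using hi
    have h2 : (⟨i, hlt⟩ : Fin n) ∈ ({p'.1, p'.2} : Finset (Fin n)) := by
      simpa [Fin.ext_iff] using hi'
    rw [eq_of_pair_eq hb hb' (π.eq_of_mem_parts (mem_blockPairs.mp hb).2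
      (mem_blockPairs.mp hb').2 h1 h2)]
  · intro p hp
    obtain ⟨p, hp, rfl⟩ := mem_toMatching.mp hp
    exact p.1.2

theorem toMatching_injOn (n : ℕ) : Set.InjOn (toMatching (n := n)) (pairPartitions n) := by
  intro π hπ π' hπ' h
  have hb : blockPairs π = blockPairs π' := Finset.map_injective _ h
  ext V
  constructor
  · intro hV
    obtain ⟨p, hp, rfl⟩ := exists_blockPairs hπ hV
    rw [hb] at hp
    exact (mem_blockPairs.mp hp).2
  · intro hV
    obtain ⟨p, hp, rfl⟩ := exists_blockPairs hπ' hV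
    rw [← hb] at hp
    exact (mem_blockPairs.mp hp).2

theorem exists_toMatching_eq {n : ℕ} {M : Finset (ℕ × ℕ)} (hM : M ∈ openMatchings n ∅) :
    ∃ π ∈ pairPartitions n, toMatching π = M := by
  classical
  rw [mem_openMatchings, Finset.union_empty] at hM
  have hM := hM.1
  let parts : Finset (Finset (Fin n)) :=
    Finset.univ.filter fun V => ∃ a b : Fin n, V = {a, b} ∧ (a.val, b.val) ∈ M
  have hparts : ∀ V, V ∈ parts ↔ ∃ a b : Fin n, V = {a, b} ∧ (a.val, b.val) ∈ M := by
    simp [parts]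
  let π : Finpartition (Finset.univ : Finset (Fin n)) :=
    Finpartition.ofExistsUnique parts (fun _ _ => Finset.subset_univ _) (by
      intro i _
      obtain ⟨⟨a, b⟩, hp, hi⟩ := hM.exists_mem i (Finset.mem_range.mpr i.2)
      have ha := Finset.mem_range.mp (hM.fst_mem _ hp)
      have hb := Finset.mem_range.mp (hM.snd_mem _ hp)
      refine ⟨{⟨a, ha⟩, ⟨b, hb⟩}, ⟨(hparts _).mpr ⟨_, _, rfl, hp⟩, by simpa [Fin.ext_iff] using hi⟩,
        ?_⟩
      rintro V ⟨hV, hiV⟩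
      obtain ⟨c, d, rfl, hcd⟩ := (hparts V).mp hV
      have := hM.eq_of_mem _ hcd _ hp i (by simpa [Fin.ext_iff] using hiV) hi
      rw [Prod.mk.injEq] at this
      rw [show c = ⟨a, ha⟩ from Fin.ext this.1, show d = ⟨b, hb⟩ from Fin.ext this.2]) (by
      intro h
      obtain ⟨a, b, he, -⟩ := (hparts _).mp h
      exact Finset.insert_ne_empty _ _ he.symm)
  have hmem : ∀ V, V ∈ π.parts ↔ ∃ a b : Fin n, V = {a, b} ∧ (a.val, b.val) ∈ M := hparts
  refine ⟨π, mem_pairPartitions.mpr fun V hV => ?_, ?_⟩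
  · obtain ⟨a, b, rfl, hab⟩ := (hmem V).mp hV
    exact Finset.card_pair (Fin.ne_of_lt (hM.lt _ hab))
  · ext ⟨a, b⟩
    rw [mem_toMatching]
    constructor
    · rintro ⟨⟨a', b'⟩, h, he⟩
      rw [← he]
      rw [mem_blockPairs] at h
      obtain ⟨c, d, hcd, hM'⟩ := (hmem _).mp h.2
      have := pair_eq_pair_of_lt h.1 (hM.lt _ hM') hcd
      rwa [this.1, this.2]
    · intro h
      have ha := Finset.mem_range.mp (hM.fst_mem _ h)
      have hb := Finset.mem_range.mp (hM.snd_mem _ h)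
      exact ⟨(⟨a, ha⟩, ⟨b, hb⟩), mem_blockPairs.mpr ⟨hM.lt _ h, (hmem _).mpr ⟨_, _, rfl, h⟩⟩, rfl⟩

theorem covers_pair_iff {n : ℕ} {a b c d : Fin n} (hab : a < b) (hcd : c < d) :
    Covers {a, b} {c, d} ↔ a < c ∧ d < b := by
  constructor
  · rintro ⟨i, hi, j, hj, h⟩
    have hc := h c (by simp)
    have hd := h d (by simp)
    rw [Finset.mem_insert, Finset.mem_singleton] at hi hj
    rcases hi with rfl | rfl <;> rcases hj with rfl | rfl
    · exact absurd (hc.1.trans hc.2) (lt_irrefl _)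
    · exact ⟨hc.1, hd.2⟩
    · exact absurd (hc.1.trans hc.2) hab.not_gt
    · exact absurd (hc.1.trans hc.2) (lt_irrefl _)
  · rintro ⟨h1, h2⟩
    refine ⟨a, by simp, b, by simp, fun k hk => ?_⟩
    rw [Finset.mem_insert, Finset.mem_singleton] at hk
    rcases hk with rfl | rfl
    · exact ⟨h1, hcd.trans h2⟩
    · exact ⟨h1.trans hcd, h2⟩

theorem matchingInner_toMatching {n : ℕ} {π : Finpartition (Finset.univ : Finset (Fin n))}
    (hπ : π ∈ pairPartitions n) : matchingInner (toMatching π) = innerBlocks π := by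
  classical
  rw [matchingInner, toMatching, Finset.filter_map, Finset.card_map, innerBlocks]
  refine Finset.card_bij (fun p _ => {p.1, p.2}) ?_ ?_ ?_
  · intro p hp
    rw [Finset.mem_filter] at hp ⊢
    obtain ⟨hp, p', hp', h⟩ := hp
    obtain ⟨p', hb', rfl⟩ := Finset.mem_map.mp hp'
    rw [mem_blockPairs] at hp hb'
    exact ⟨hp.2, _, hb'.2, (covers_pair_iff hb'.1 hp.1).mpr h⟩
  · intro p hp p' hp' h
    exact eq_of_pair_eq (Finset.mem_filter.mp hp).1 (Finset.mem_filter.mp hp').1 h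
  · intro V hV
    rw [Finset.mem_filter] at hV
    obtain ⟨hV, W, hW, hWV⟩ := hV
    obtain ⟨p, hp, rfl⟩ := exists_blockPairs hπ hV
    obtain ⟨p', hp', rfl⟩ := exists_blockPairs hπ hW
    rw [covers_pair_iff (mem_blockPairs.mp hp').1 (mem_blockPairs.mp hp).1] at hWV
    exact ⟨p, Finset.mem_filter.mpr ⟨hp, _, Finset.mem_map_of_mem _ hp', hWV⟩, rfl⟩

/-- One side counts ordered pairs, the other unordered sets of blocks. The counts agree because the
block with the smaller left end always comes first. -/
theorem matchingCrossings_toMatching {n : ℕ} {π : Finpartition (Finset.univ : Finset (Fin n))}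
    (hπ : π ∈ pairPartitions n) : matchingCrossings (toMatching π) = crossings π := by
  classical
  have h1 : matchingCrossings (toMatching π) = ((blockPairs π ×ˢ blockPairs π).filter fun P =>
      P.1.1 < P.2.1 ∧ P.2.1 < P.1.2 ∧ P.1.2 < P.2.2).card := by
    rw [matchingCrossings, toMatching, ← Finset.prodMap_map_product, Finset.filter_map,
      Finset.card_map]
    rfl
  rw [h1, crossings]
  refine Finset.card_bij (fun P _ => {{P.1.1, P.1.2}, {P.2.1, P.2.2}}) ?_ ?_ ?_
  · rintro ⟨p, p'⟩ hP
    simp only [Finset.mem_filter, Finset.mem_product] at hP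
    obtain ⟨⟨hp, hp'⟩, h1, h2, h3⟩ := hP
    have hne : ({p.1, p.2} : Finset (Fin n)) ≠ {p'.1, p'.2} := fun h => by
      rw [eq_of_pair_eq hp hp' h] at h1
      exact lt_irrefl _ h1
    rw [Finset.mem_filter, Finset.mem_powersetCard]
    refine ⟨⟨?_, Finset.card_pair hne⟩, _, Finset.mem_insert_self _ _, _,
      Finset.mem_insert_of_mem (Finset.mem_singleton_self _), hne, p.1, by simp, p.2, by simp,
      p'.1, by simp, p'.2, by simp, h1, h2, h3⟩
    intro V hV
    rw [Finset.mem_insert, Finset.mem_singleton] at hV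
    rcases hV with rfl | rfl
    · exact (mem_blockPairs.mp hp).2
    · exact (mem_blockPairs.mp hp').2
  · rintro ⟨p₁, p₂⟩ hP ⟨p₁', p₂'⟩ hP' h
    simp only [Finset.mem_filter, Finset.mem_product] at hP hP'
    obtain ⟨⟨hp₁, hp₂⟩, h1, -⟩ := hP
    obtain ⟨⟨hp₁', hp₂'⟩, h1', -⟩ := hP'
    have e1 : ({p₁.1, p₁.2} : Finset (Fin n)) = {p₁'.1, p₁'.2} ∨
        ({p₁.1, p₁.2} : Finset (Fin n)) = {p₂'.1, p₂'.2} := by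
      rw [← Finset.mem_singleton (a := {p₂'.1, p₂'.2}), ← Finset.mem_insert]
      exact h ▸ Finset.mem_insert_self _ _
    have e2 : ({p₂.1, p₂.2} : Finset (Fin n)) = {p₁'.1, p₁'.2} ∨
        ({p₂.1, p₂.2} : Finset (Fin n)) = {p₂'.1, p₂'.2} := by
      rw [← Finset.mem_singleton (a := {p₂'.1, p₂'.2}), ← Finset.mem_insert]
      exact h ▸ Finset.mem_insert_of_mem (Finset.mem_singleton_self _)
    rcases e1 with e1 | e1
    · have e1 := eq_of_pair_eq hp₁ hp₁' e1
      rcases e2 with e2 | e2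
      · have e2 := eq_of_pair_eq hp₂ hp₁' e2
        rw [e1, e2] at h1
        exact absurd h1 (lt_irrefl _)
      · rw [e1, eq_of_pair_eq hp₂ hp₂' e2]
    · have e1 := eq_of_pair_eq hp₁ hp₂' e1
      rcases e2 with e2 | e2
      · have e2 := eq_of_pair_eq hp₂ hp₁' e2
        rw [e1, e2] at h1
        exact absurd h1 h1'.not_gt
      · have e2 := eq_of_pair_eq hp₂ hp₂' e2
        rw [e1, e2] at h1
        exact absurd h1 (lt_irrefl _)
  · intro S hS
    rw [Finset.mem_filter, Finset.mem_powersetCard] at hS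
    obtain ⟨⟨hS, hcard⟩, V, hV, W, hW, hne, i, hi, j, hj, k, hk, l, hl, hik, hkj, hjl⟩ := hS
    have hSVW : S = {V, W} := by
      refine (Finset.eq_of_subset_of_card_le ?_ ?_).symm
      · intro U hU
        rw [Finset.mem_insert, Finset.mem_singleton] at hU
        rcases hU with rfl | rfl <;> assumption
      · rw [hcard, Finset.card_pair hne]
    have hpair : ∀ {U : Finset (Fin n)} {a b : Fin n}, U ∈ π.parts → a ∈ U → b ∈ U → a < b →
        U = {a, b} ∧ (a, b) ∈ blockPairs π := by
      intro U a b hU ha hb hab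
      have h : ({a, b} : Finset (Fin n)) = U := by
        refine Finset.eq_of_subset_of_card_le ?_ ?_
        · intro c hc
          rw [Finset.mem_insert, Finset.mem_singleton] at hc
          rcases hc with rfl | rfl <;> assumption
        · rw [mem_pairPartitions.mp hπ U hU, Finset.card_pair hab.ne]
      exact ⟨h.symm, mem_blockPairs.mpr ⟨hab, h.symm ▸ hU⟩⟩
    obtain ⟨rfl, hp⟩ := hpair (hS hV) hi hj (hik.trans hkj)
    obtain ⟨rfl, hp'⟩ := hpair (hS hW) hk hl (hkj.trans hjl)
    exact ⟨((i, j), (k, l)), Finset.mem_filter.mpr ⟨Finset.mem_product.mpr ⟨hp, hp'⟩, hik, hkj, hjl⟩,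
      hSVW.symm⟩

theorem sum_pairPartitions {n : ℕ} {A : Type*} [AddCommMonoid A] (F : Finset (ℕ × ℕ) → A) :
    ∑ π ∈ pairPartitions n, F (toMatching π) = ∑ M ∈ openMatchings n ∅, F M := by
  refine Finset.sum_bij (fun π _ => toMatching π) (fun π hπ => toMatching_mem hπ)
    (fun π hπ π' hπ' h => toMatching_injOn n hπ hπ' h) (fun M hM => ?_) fun _ _ => rfl
  obtain ⟨π, hπ, h⟩ := exists_toMatching_eq hM
  exact ⟨π, hπ, h⟩

theorem pairProduct_eq_prod_toMatching {n : ℕ}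
    (π : Finpartition (Finset.univ : Finset (Fin n))) (x : Fin n → H) (x' : ℕ → H)
    (hx : ∀ i : Fin n, x' i = x i) :
    pairProduct π x = ∏ p ∈ toMatching π, inner ℂ (x' p.1) (x' p.2) := by
  rw [toMatching, Finset.prod_map, pairProduct, blockPairs]
  refine Finset.prod_congr rfl fun p _ => ?_
  rw [← hx, ← hx]
  rfl

/-! ### Moments of the Gaussian operators -/

theorem prod_gaussian_sub_mem_radical {α q : ℝ} (h : α = 0 ∨ q = 0) {J : H →ₗ[ℂ] H}
    (hJ : J.IsSymmetric) (c : ℂ) (x : ℕ → H) (L : List ℕ) (v : Fock H) :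
    (L.map fun i => c • gaussian α q J (x i)).prod v -
      (L.map fun i => c • (annihilate α q J (x i) + creation (x i))).prod v ∈ radical α q J := by
  induction L with
  | nil => simp
  | cons i L ih =>
    simp only [List.map_cons, List.prod_cons, Module.End.mul_apply]
    set u := (L.map fun i => c • gaussian α q J (x i)).prod v
    set u' := (L.map fun i => c • (annihilate α q J (x i) + creation (x i))).prod v
    have hadj := isFockAdjoint_annihilation h hJ (x i)
    have h1 := hadj.apply_mem_radical ih
    have h2 := (hadj.symm hJ).apply_mem_radical ih
    have h3 := hadj.sub_mem_radical (isFockAdjoint_annihilate h hJ (x i)) u'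
    -- With B the chosen and B' the explicit adjoint of creation C, (B + C)u - (B' + C)u' = B(u -
    -- u') + C(u - u') + (Bu' - B'u').
    have h4 := (radical α q J).smul_mem c (add_mem (add_mem h1 h2) h3)
    convert h4 using 1
    rw [gaussian, LinearMap.smul_apply, LinearMap.smul_apply, ← smul_sub, LinearMap.add_apply,
      LinearMap.add_apply, map_sub, map_sub]
    congr 1
    abel

/-- For α = 0 also t = 1 and nothing happens. For q = 0 only the least element k of s has nonzero
weight, and then s = {k} means that nothing lies above k: the coefficient becomes t(1 + α) = 1 in
this case and t otherwise. -/
theorem weight_eq {α q t : ℝ} (h : α = 0 ∨ q = 0) (ht : t * (1 + α) = 1) {s : Finset ℕ} {k : ℕ}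
    (hk : k ∈ s) [Decidable (∃ i ∈ s, k < i)] :
    (t : ℂ) * ((q : ℂ) ^ (s.filter (· < k)).card * (1 + if s = {k} then (α : ℂ) else 0)) =
      (q : ℂ) ^ (s.filter (· < k)).card * (t : ℂ) ^ (if ∃ i ∈ s, k < i then 1 else 0) := by
  have ht' : (t : ℂ) * (1 + α) = 1 := by exact_mod_cast ht
  rcases h with rfl | rfl
  · have : t = 1 := by simpa using ht
    subst this
    simp
  · by_cases hc : (s.filter (· < k)).card = 0
    · rw [hc, pow_zero, one_mul, one_mul]
      rw [Finset.card_eq_zero, Finset.filter_eq_empty_iff] at hc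
      by_cases hs : s = {k}
      · rw [if_pos hs, if_neg, ht', pow_zero]
        rintro ⟨i, hi, hki⟩
        rw [hs, Finset.mem_singleton] at hi
        exact hki.ne' hi
      · rw [if_neg hs, if_pos, add_zero, mul_one, pow_one]
        by_contra! hcon
        exact hs (Finset.eq_singleton_iff_unique_mem.mpr
          ⟨hk, fun i hi => le_antisymm (hcon i hi) (not_lt.mp (hc hi))⟩)
    · rw [Complex.ofReal_zero, zero_pow hc]
      simp

theorem fockForm_vacuum_prod_gaussian {α q t c : ℝ} (h : α = 0 ∨ q = 0) (ht : t * (1 + α) = 1)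
    (hc : c * c = t) {J : H →ₗ[ℂ] H} (hJ : J.IsSymmetric) {n : ℕ} (x : Fin n → H)
    (hx : ∀ i, J (x i) = x i) :
    fockForm α q J (vacuum H)
        ((List.ofFn fun i => (c : ℂ) • gaussian α q J (x i)).prod (vacuum H)) =
      ∑ π ∈ pairPartitions n,
        (q : ℂ) ^ crossings π * (t : ℂ) ^ innerBlocks π * pairProduct π x := by
  classical
  -- Indices become natural numbers; the default value 0 is again fixed by J.
  let x' : ℕ → H := fun i => if h : i < n then x ⟨i, h⟩ else 0
  have hx' : ∀ i : Fin n, x' i = x i := fun i => dif_pos i.2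
  have hJx : ∀ i, J (x' i) = x' i := by
    intro i
    by_cases hi : i < n
    · simp only [x', dif_pos hi, hx]
    · simp only [x', dif_neg hi, map_zero]
  have hc' : (c : ℂ) * c = t := by exact_mod_cast hc
  have hlist : (List.ofFn fun i => (c : ℂ) • gaussian α q J (x i)) =
      (List.range n).map fun i => (c : ℂ) • gaussian α q J (x' i) := by
    refine List.ext_getElem (by simp) fun i h1 h2 => ?_
    simp only [List.getElem_ofFn, List.getElem_map, List.getElem_range]
    rw [← hx']
  have hrad := prod_gaussian_sub_mem_radical h hJ c x' (List.range n) (vacuum H) (vacuum H)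
  rw [sub_eq_add_neg, ← neg_one_smul ℂ, fockForm_add_right, fockForm_smul_right] at hrad
  let φ : Fock H →ₗ[ℂ] ℂ :=
    { toFun := fockForm α q J (vacuum H)
      map_add' := fockForm_add_right α q J _
      map_smul' := fun a g => fockForm_smul_right α q J a _ g }
  have hrec := sum_openMatchings_of_recursion
    (fun i => (c : ℂ) • (annihilate α q J (x' i) + creation (x' i)))
    -- The power of c makes the coefficient of opening a point 1. Closing a point lowers the
    -- cardinality by one and thus leaves c * c = t.
    (fun s => (c : ℂ) ^ s.card • setTensor x' s) φ q t (fun i j => inner ℂ (x' i) (x' j))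
    (by
      intro s
      rw [map_smul]
      change (c : ℂ) ^ s.card • fockForm α q J (vacuum H) (setTensor x' s) = _
      rw [fockForm_vacuum_setTensor]
      split_ifs with hs
      · simp [hs]
      · simp)
    (by
      intro j s hs
      have hjs : j ∉ s := fun h => lt_irrefl _ (hs j h)
      rw [LinearMap.smul_apply, map_smul, smul_smul, LinearMap.add_apply, smul_add, add_comm,
        setTensor_insert x' hs, Finset.card_insert_of_notMem hjs, ← pow_succ',
        annihilate_setTensor h J (hJx j), Finset.smul_sum]
      congr 1
      refine Finset.sum_congr rfl fun k hk => ?_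
      rw [smul_smul, smul_smul, ← weight_eq h ht hk, ← Finset.card_erase_add_one hk, ← hc']
      congr 1
      ring)
    n ∅ (by simp)
  rw [Finset.card_empty, pow_zero, one_smul, setTensor_empty] at hrec
  -- The vacuum is orthogonal to the radical, so the chosen adjoints can be replaced by the explicit
  -- ones.
  rw [hlist, show fockForm α q J (vacuum H) (((List.range n).map fun i =>
    (c : ℂ) • gaussian α q J (x' i)).prod (vacuum H)) = _ from
    (eq_neg_of_add_eq_zero_left hrad).trans (by rw [neg_one_mul, neg_neg])]
  refine hrec.trans ?_
  rw [← sum_pairPartitions]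
  refine Finset.sum_congr rfl fun π hπ => ?_
  rw [matchingCrossings_toMatching hπ, matchingInner_toMatching hπ,
    pairProduct_eq_prod_toMatching π x x' hx']

end TypeBFock

end

theorem mainTheorem7 {H : Type*} [NormedAddCommGroup H] [InnerProductSpace ℂ H] [CompleteSpace H]
    [TopologicalSpace.SeparableSpace H]
    (HR : Submodule ℝ H) (hHR : TypeBFock.IsRealForm HR)
    (J : H →ₗ[ℂ] H) (hJ : Function.Involutive J) (hJsym : J.IsSymmetric) :
    -- the case `α = 0`
    (∀ q : ℝ, -1 < q → q < 1 →
      (∀ x : H, TypeBFock.IsFockAdjoint 0 q J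
        (TypeBFock.creation x) (TypeBFock.annihilation 0 q J x)) ∧
      ∀ (m : ℕ) (x : Fin (2 * m) → H), (∀ i, x i ∈ HR) → (∀ i, J (x i) = x i) →
        TypeBFock.fockForm 0 q J (TypeBFock.vacuum H)
            ((List.ofFn fun i => TypeBFock.gaussian 0 q J (x i)).prod (TypeBFock.vacuum H)) =
          ∑ π ∈ TypeBFock.pairPartitions (2 * m),
            (q : ℂ) ^ TypeBFock.crossings π * TypeBFock.pairProduct π x) ∧
    -- the case `q = 0`
    (∀ α t : ℝ, -1 < α → t = 1 / (1 + α) →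
      (∀ n : ℕ, 1 ≤ n →
        TypeBFock.symmetrizer α 0 J n
            = LinearMap.id + (α : ℂ) • TypeBFock.firstInvolution J n ∧
        (α < 1 → ∀ ξ : ⨂[ℂ]^n H, ξ ≠ 0 →
          0 < TypeBFock.tensorInner n ξ (TypeBFock.symmetrizer α 0 J n ξ)) ∧
        (∀ ξ ∈ Submodule.span ℂ {η : ⨂[ℂ]^n H | ∃ y : Fin n → H,
            (∀ i, J (y i) = y i) ∧ PiTensorProduct.tprod ℂ y = η}, ξ ≠ 0 →
          0 < TypeBFock.tensorInner n ξ (TypeBFock.symmetrizer α 0 J n ξ))) ∧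
      (∀ x : H, TypeBFock.IsFockAdjoint α 0 J
        (TypeBFock.creation x) (TypeBFock.annihilation α 0 J x)) ∧
      ∀ (m : ℕ) (x : Fin (2 * m) → H), (∀ i, x i ∈ HR) → (∀ i, J (x i) = x i) →
        TypeBFock.fockForm α 0 J (TypeBFock.vacuum H)
            ((List.ofFn fun i => ((√t : ℝ) : ℂ) • TypeBFock.gaussian α 0 J (x i)).prod
              (TypeBFock.vacuum H)) =
          ∑ π ∈ TypeBFock.noncrossingPairPartitions (2 * m),
            (t : ℂ) ^ TypeBFock.innerBlocks π * TypeBFock.pairProduct π x) := by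
  refine ⟨fun q _ _ => ⟨fun x => TypeBFock.isFockAdjoint_annihilation (Or.inl rfl) hJsym x,
    fun m x _ hx => ?_⟩, fun α t hα ht => ⟨fun n hn => ?_, fun x =>
    TypeBFock.isFockAdjoint_annihilation (Or.inr rfl) hJsym x, fun m x _ hx => ?_⟩⟩
  -- With t = 1 inner blocks carry no weight, and c = 1 leaves the operators unscaled.
  · have h := TypeBFock.fockForm_vacuum_prod_gaussian (α := 0) (q := q) (t := 1) (c := 1)
      (Or.inl rfl) (by norm_num) (by norm_num) hJsym x hx
    simpa using h
  · obtain ⟨n, rfl⟩ := Nat.exists_eq_succ_of_ne_zero (Nat.one_le_iff_ne_zero.mp hn)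
    exact ⟨TypeBFock.symmetrizer_zero_right_succ α J n,
      fun h1 ξ hξ => TypeBFock.symmetrizer_zero_right_pos hα h1 hJ hJsym hξ,
      fun ξ hmem hξ => TypeBFock.symmetrizer_zero_right_pos_of_mem_span hα hmem hξ⟩
  · have hpos : 0 < 1 + α := by linarith
    have htpos : 0 ≤ t := by rw [ht]; positivity
    rw [TypeBFock.fockForm_vacuum_prod_gaussian (Or.inr rfl)
      (by rw [ht, one_div_mul_cancel hpos.ne']) (Real.mul_self_sqrt htpos) hJsym x hx,
      TypeBFock.noncrossingPairPartitions, Finset.sum_filter]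
    -- Since 0 ^ 0 = 1, the weight `0 ^ crossings π` is the indicator of the noncrossing partitions.
    refine Finset.sum_congr rfl fun π _ => ?_
    split_ifs with h
    · rw [h, pow_zero, one_mul]
    · rw [Complex.ofReal_zero, zero_pow h, zero_mul, zero_mul]
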